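/- **Setting.** Let $\mathcal S=\mathcal S(\mathbb R^d)$ be the space of real rapidly decreasing smooth functions, $\mathcal S'$ its dual, and $h_k$, $k\in\mathbb Z_+^d$, the $L^2(\mathbb R^d)$-orthonormal Hermite functions. For $p\in\mathbb R$ put $$\langle f,g\rangle_p=\sum_{k\in\mathbb Z_+^d}(2|k|+d)^{2p}\langle f,h_k\rangle\langle g,h_k\rangle,\qquad \|f\|_p^2=\langle f,f\rangle_p ,$$ and let $\mathcal S_p\subset\mathcal S'$ be the completion of $\mathcal S$ in $\|\cdot\|_p$, i.e. the space of all $f\in\mathcal S'$ with $\sum_k(2|k|+d)^{2p}\langle f,h_k\rangle^2<\infty$. Write $B_p(0,\lambda)=\{\phi\in\mathcal S_p:\|\phi\|_p\le\lambda\}$. For functions $\sigma_{ij},b_i:\mathcal S_p\to\mathbb R$, $1\le i\le d$, $1\le j\le n$, let $a(\phi)=\sigma(\phi)\sigma(\phi)^t$ and, with distributional derivatives, $$A_i(\phi)=-\sum_{k=1}^d\sigma_{ki}(\phi)\,\partial_k\phi\quad(1\le i\le n),\qquad L(\phi)=\frac12\sum_{i,j=1}^d a_{ij}(\phi)\,\partial^2_{ij}\phi-\sum_{i=1}^d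 b_i(\phi)\,\partial_i\phi ,$$ $A(\phi)h=\sum_{i=1}^n h_iA_i(\phi)$ for $h\in\mathbb R^n$, and let $\|T\|_{HS(q)}^2=\sum_{i=1}^n\|Te_i\|_q^2$ for linear $T:\mathbb R^n\to\mathcal S_q$, where $e_1,\dots,e_n$ is the standard basis of $\mathbb R^n$. For $\lambda>0$ let $$K_1(\lambda)=\max_{i,j}\ \sup_{\|\phi\|_p\le\lambda}\{|\sigma_{ij}(\phi)|^2,\ |b_i(\phi)|\}.$$ **Theorem 3.2.** Let $p\in\mathbb R$, $q\le p-1$, let $\lambda>0$, and suppose that there is $K(\lambda)>0$ such that $$|\sigma_{ij}(\phi)-\sigma_{ij}(\psi)|\le K(\lambda)\|\phi-\psi\|_q,\qquad |b_i(\phi)-b_i(\psi)|\le K(\lambda)\|\phi-\psi\|_q$$ for all $\phi,\psi\in B_p(0,\lambda)$ and all $1\le i\le d$, $1\le j\le n$. Then $L$ and $A_1,\dots,A_n$ map $\mathcal S_p$ into $\mathcal S_q$, and there is a constant $C=C(n,d,p,q,\lambda,K(\lambda),K_1(\lambda))$, depending on $\sigma$ and $b$ only through $K(\lambda)$ and $K_1(\lambda)$,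 such that $$2\langle\phi-\psi,\,L(\phi)-L(\psi)\rangle_q+\|A(\phi)-A(\psi)\|_{HS(q)}^2\le C\,\|\phi-\psi\|_q^2\qquad\text{for all }\phi,\psi\in B_p(0,\lambda).$$ -/

import Mathlib

open scoped SchwartzMap

noncomputable section

/-! ### Hermite functions on `ℝ` and on `ℝ^d` -/

/-- The `n`-th `L²`-normalised Hermite function on the real line,
`(2^n n! √π)^(-1/2) Hₙ(x) exp(-x²/2)` with `Hₙ` the physicists' Hermite polynomial. It is written
with Mathlib's (probabilists') Hermite polynomial `Heₙ` through `Hₙ(x) = 2^(n/2) Heₙ(√2 x)`. -/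
def hermiteFun (n : ℕ) (x : ℝ) : ℝ :=
  (Real.sqrt ((n.factorial : ℝ) * Real.sqrt Real.pi))⁻¹ *
    Polynomial.aeval (Real.sqrt 2 * x) (Polynomial.hermite n) * Real.exp (-x ^ 2 / 2)

/-- The function `exp (-t / 2)` has all derivatives bounded by itself. -/
theorem norm_iteratedFDeriv_exp_neg_half (n : ℕ) (t : ℝ) :
    ‖iteratedFDeriv ℝ n (fun s : ℝ => Real.exp (-(1 / 2) * s)) t‖ ≤ Real.exp (-t / 2) := by
  rw [norm_iteratedFDeriv_eq_norm_iteratedDeriv]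
  have h : iteratedDeriv n (fun s : ℝ => Real.exp (-(1 / 2) * s)) =
      fun s => (-(1 / 2) : ℝ) ^ n * Real.exp (-(1 / 2) * s) := iteratedDeriv_exp_const_mul n _
  rw [h]
  simp only [norm_mul, norm_pow, Real.norm_eq_abs, Real.abs_exp]
  have h1 : |(-(1 / 2) : ℝ)| ^ n ≤ 1 := pow_le_one₀ (abs_nonneg _) (by norm_num [abs_le])
  calc |(-(1 / 2) : ℝ)| ^ n * Real.exp (-(1 / 2) * t) ≤ 1 * Real.exp (-(1 / 2) * t) := by gcongr
    _ = Real.exp (-t / 2) := by rw [one_mul]; congr 1; ring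

/-- The standard Gaussian `exp (-‖x‖² / 2)` as a Schwartz function. -/
def gaussianSchwartz (d : ℕ) : 𝓢(EuclideanSpace ℝ (Fin d), ℝ) where
  toFun x := Real.exp (-(1 / 2) * ‖x‖ ^ 2)
  smooth' := Real.contDiff_exp.comp (contDiff_const.mul (contDiff_id.norm_sq ℝ))
  decay' m n := by
    obtain ⟨k, C, hC, hf⟩ := (Function.hasTemperateGrowth_norm_sq
      (EuclideanSpace ℝ (Fin d))).norm_iteratedFDeriv_le_uniform n
    refine ⟨(n.factorial : ℝ) * (C + 1) ^ n * (((m + k * n).factorial : ℝ) * Real.exp (3 / 2)), fun x => ?_⟩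
    have hx : 0 ≤ ‖x‖ := norm_nonneg x
    have h1 : 1 ≤ (C + 1) * (1 + ‖x‖) ^ k := by
      have : 1 ≤ (1 + ‖x‖) ^ k := one_le_pow₀ (by linarith)
      nlinarith
    have key := norm_iteratedFDeriv_comp_le (𝕜 := ℝ) (N := ⊤) (n := n)
      (g := fun s : ℝ => Real.exp (-(1 / 2) * s)) (f := fun y : EuclideanSpace ℝ (Fin d) => ‖y‖ ^ 2)
      (Real.contDiff_exp.comp (contDiff_const.mul contDiff_id)) (contDiff_id.norm_sq ℝ) le_top x
      (C := Real.exp (-‖x‖ ^ 2 / 2)) (D := (C + 1) * (1 + ‖x‖) ^ k)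
      (fun i _ => norm_iteratedFDeriv_exp_neg_half i _)
      (fun i hi hin => (hf i hin x).trans (by
        calc C * (1 + ‖x‖) ^ k ≤ (C + 1) * (1 + ‖x‖) ^ k := by gcongr; linarith
          _ ≤ ((C + 1) * (1 + ‖x‖) ^ k) ^ i := le_self_pow₀ h1 (by omega)))
    have hpow : (1 + ‖x‖) ^ (m + k * n) ≤ ((m + k * n).factorial : ℝ) * Real.exp (1 + ‖x‖) := by
      have := Real.pow_div_factorial_le_exp (1 + ‖x‖) (by linarith) (m + k * n)
      rwa [div_le_iff₀ (by positivity), mul_comm (Real.exp _)] at this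
    have hexp : Real.exp (1 + ‖x‖) * Real.exp (-‖x‖ ^ 2 / 2) ≤ Real.exp (3 / 2) := by
      rw [← Real.exp_add]
      apply Real.exp_le_exp.2
      nlinarith [sq_nonneg (‖x‖ - 1)]
    calc ‖x‖ ^ m * ‖iteratedFDeriv ℝ n (fun y : EuclideanSpace ℝ (Fin d) =>
          Real.exp (-(1 / 2) * ‖y‖ ^ 2)) x‖
        ≤ (1 + ‖x‖) ^ m * ((n.factorial : ℝ) * Real.exp (-‖x‖ ^ 2 / 2) * ((C + 1) * (1 + ‖x‖) ^ k) ^ n) := by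
          gcongr
          · linarith
          · exact key
      _ = (n.factorial : ℝ) * (C + 1) ^ n * ((1 + ‖x‖) ^ (m + k * n) * Real.exp (-‖x‖ ^ 2 / 2)) := by
          rw [mul_pow, ← pow_mul, pow_add]; ring
      _ ≤ (n.factorial : ℝ) * (C + 1) ^ n * (((m + k * n).factorial : ℝ) * Real.exp (1 + ‖x‖) * Real.exp (-‖x‖ ^ 2 / 2)) := by
          gcongr
      _ ≤ (n.factorial : ℝ) * (C + 1) ^ n * (((m + k * n).factorial : ℝ) * Real.exp (3 / 2)) := by
          rw [mul_assoc ((m + k * n).factorial : ℝ)]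
          gcongr

/-- A polynomial in one coordinate has temperate growth. -/
theorem hasTemperateGrowth_aeval_coord (d : ℕ) (j : Fin d) (P : Polynomial ℤ) :
    Function.HasTemperateGrowth (fun x : EuclideanSpace ℝ (Fin d) =>
      Polynomial.aeval (Real.sqrt 2 * x j) P) := by
  have hx : Function.HasTemperateGrowth (fun x : EuclideanSpace ℝ (Fin d) => x j) :=
    (EuclideanSpace.proj (𝕜 := ℝ) j).hasTemperateGrowth
  induction P using Polynomial.induction_on' with
  | add p q hp hq => simpa only [map_add] using! hp.add hq
  | monomial n a =>
    simp only [Polynomial.aeval_monomial]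
    fun_prop

/-- The polynomial factor of the `k`-th Hermite function on `ℝ^d`. -/
def hermitePolyFactor (d : ℕ) (k : Fin d → ℕ) (x : EuclideanSpace ℝ (Fin d)) : ℝ :=
  ∏ j, ((Real.sqrt (((k j).factorial : ℝ) * Real.sqrt Real.pi))⁻¹ *
    Polynomial.aeval (Real.sqrt 2 * x j) (Polynomial.hermite (k j)))

theorem hasTemperateGrowth_hermitePolyFactor (d : ℕ) (k : Fin d → ℕ) :
    Function.HasTemperateGrowth (hermitePolyFactor d k) := by
  have h : ∀ s : Finset (Fin d), Function.HasTemperateGrowth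
      (fun x : EuclideanSpace ℝ (Fin d) =>
        ∏ j ∈ s, ((Real.sqrt (((k j).factorial : ℝ) * Real.sqrt Real.pi))⁻¹ *
          Polynomial.aeval (Real.sqrt 2 * x j) (Polynomial.hermite (k j)))) := by
    intro s
    induction s using Finset.induction_on with
    | empty => simp
    | insert a s ha ih =>
      simp only [Finset.prod_insert ha]
      exact ((Function.HasTemperateGrowth.const _).mul
        (hasTemperateGrowth_aeval_coord d a _)).mul ih
  exact h Finset.univ

theorem prod_hermiteFun_eq (d : ℕ) (k : Fin d → ℕ) :
    (fun x : EuclideanSpace ℝ (Fin d) => ∏ j, hermiteFun (k j) (x j)) =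
      SchwartzMap.smulLeftCLM ℝ (hermitePolyFactor d k) (gaussianSchwartz d) := by
  ext x
  rw [SchwartzMap.smulLeftCLM_apply_apply (hasTemperateGrowth_hermitePolyFactor d k)]
  change _ = hermitePolyFactor d k x * Real.exp (-(1 / 2) * ‖x‖ ^ 2)
  have : -(1 / 2) * ‖x‖ ^ 2 = ∑ j, (-(x j) ^ 2 / 2) := by
    rw [EuclideanSpace.real_norm_sq_eq, Finset.mul_sum]
    exact Finset.sum_congr rfl fun j _ => by ring
  rw [this, Real.exp_sum, hermitePolyFactor, ← Finset.prod_mul_distrib]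
  rfl

/-- The `k`-th Hermite function `h_k(x) = ∏ⱼ h_{kⱼ}(xⱼ)` on `ℝ^d`, for a multi-index `k`, as an
element of the Schwartz space of real rapidly decreasing functions. -/
def hermiteSchwartz (d : ℕ) (k : Fin d → ℕ) : 𝓢(EuclideanSpace ℝ (Fin d), ℝ) where
  toFun x := ∏ j, hermiteFun (k j) (x j)
  smooth' := by
    rw [prod_hermiteFun_eq]
    exact SchwartzMap.smooth _ ⊤
  decay' := by
    rw [prod_hermiteFun_eq]
    exact SchwartzMap.decay' _

/-! ### Real tempered distributions and the Hermite-Sobolev spaces -/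

/-- Real tempered distributions on `ℝ^d`: the continuous dual of the real Schwartz space. -/
abbrev RealTempered (d : ℕ) : Type := 𝓢(EuclideanSpace ℝ (Fin d), ℝ) →L[ℝ] ℝ

/-- The distributional partial derivative, `⟨∂ⱼ T, f⟩ = -⟨T, ∂ⱼ f⟩`. -/
def RealTempered.partialDeriv {d : ℕ} (j : Fin d) (T : RealTempered d) : RealTempered d :=
  -(T ∘L LineDeriv.lineDerivOpCLM ℝ 𝓢(EuclideanSpace ℝ (Fin d), ℝ)
      (EuclideanSpace.single j (1 : ℝ)))

/-- The weight `(2|k| + d)^(2p)`. -/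
def hermiteWeight {d : ℕ} (p : ℝ) (k : Fin d → ℕ) : ℝ :=
  (2 * ((∑ j, k j : ℕ) : ℝ) + (d : ℝ)) ^ (2 * p)

theorem hermiteWeight_nonneg {d : ℕ} (p : ℝ) (k : Fin d → ℕ) : 0 ≤ hermiteWeight p k :=
  Real.rpow_nonneg (by positivity) _

/-- The Hermite-Sobolev space `S_p` inside the tempered distributions: all `T` whose Hermite
coefficients `⟨T, h_k⟩` satisfy `∑ₖ (2|k| + d)^(2p) ⟨T, h_k⟩² < ∞`. This is the completion of the
Schwartz space for the norm `‖·‖_p`, realised as a space of tempered distributions. -/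
def hermiteSobolev (d : ℕ) (p : ℝ) : Submodule ℝ (RealTempered d) where
  carrier := {T | Summable fun k : Fin d → ℕ =>
    hermiteWeight p k * (T (hermiteSchwartz d k)) ^ 2}
  zero_mem' := by simp [summable_zero]
  add_mem' := by
    intro S T hS hT
    refine Summable.of_nonneg_of_le
      (fun k => mul_nonneg (hermiteWeight_nonneg p k) (sq_nonneg _)) (fun k => ?_)
      ((hS.add hT).mul_left 2)
    have hw := hermiteWeight_nonneg p k
    have h2 : ((S + T) (hermiteSchwartz d k)) ^ 2 ≤
        2 * ((S (hermiteSchwartz d k)) ^ 2 + (T (hermiteSchwartz d k)) ^ 2) := by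
      rw [add_apply]
      nlinarith [sq_nonneg (S (hermiteSchwartz d k) - T (hermiteSchwartz d k))]
    nlinarith [mul_le_mul_of_nonneg_left h2 hw]
  smul_mem' := by
    intro c T hT
    refine (Summable.mul_left (c ^ 2) hT).congr fun k => ?_
    simp only [smul_apply, smul_eq_mul]
    ring

/-- `S_p ⊆ S_q` for `q ≤ p`. -/
theorem hermiteSobolev_mono (d : ℕ) {p q : ℝ} (h : q ≤ p) :
    hermiteSobolev d p ≤ hermiteSobolev d q := by
  intro T hT
  rcases Nat.eq_zero_or_pos d with rfl | hd
  · exact (hasSum_fintype _).summable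
  · refine Summable.of_nonneg_of_le
      (fun k => mul_nonneg (hermiteWeight_nonneg q k) (sq_nonneg _)) (fun k => ?_) hT
    have h1 : (1 : ℝ) ≤ 2 * ((∑ j, k j : ℕ) : ℝ) + (d : ℝ) := by
      have : (1 : ℝ) ≤ d := by exact_mod_cast hd
      have : (0 : ℝ) ≤ ((∑ j, k j : ℕ) : ℝ) := Nat.cast_nonneg _
      linarith
    exact mul_le_mul_of_nonneg_right
      (Real.rpow_le_rpow_of_exponent_le h1 (by linarith)) (sq_nonneg _)

/-- The inner product `⟨S, T⟩_p = ∑ₖ (2|k| + d)^(2p) ⟨S, h_k⟩ ⟨T, h_k⟩`. The series converges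
absolutely for `S, T ∈ S_p`. -/
def hermiteInner {d : ℕ} (p : ℝ) (S T : RealTempered d) : ℝ :=
  ∑' k : Fin d → ℕ, hermiteWeight p k * S (hermiteSchwartz d k) * T (hermiteSchwartz d k)

/-- The series defining `⟨S, T⟩_p` converges for `S, T ∈ S_p`. -/
theorem summable_hermiteInner {d : ℕ} {p : ℝ} {S T : RealTempered d}
    (hS : S ∈ hermiteSobolev d p) (hT : T ∈ hermiteSobolev d p) :
    Summable fun k : Fin d → ℕ =>
      hermiteWeight p k * S (hermiteSchwartz d k) * T (hermiteSchwartz d k) := by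
  refine Summable.of_norm_bounded (Summable.add hS hT) (fun k => ?_)
  have hw := hermiteWeight_nonneg p k
  set s := S (hermiteSchwartz d k)
  set t := T (hermiteSchwartz d k)
  have h : |s * t| ≤ s ^ 2 + t ^ 2 :=
    abs_le.2 ⟨by nlinarith [sq_nonneg (s + t)], by nlinarith [sq_nonneg (s - t)]⟩
  rw [Real.norm_eq_abs, mul_assoc, abs_mul, abs_of_nonneg hw, ← mul_add]
  exact mul_le_mul_of_nonneg_left h hw

/-- The norm `‖T‖_p = √⟨T, T⟩_p`. -/
def hermiteNorm {d : ℕ} (p : ℝ) (T : RealTempered d) : ℝ :=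
  Real.sqrt (hermiteInner p T T)

/-- The closed ball `B_p(0, lam) = {φ ∈ S_p : ‖φ‖_p ≤ lam}`. -/
def hermiteBall (d : ℕ) (p lam : ℝ) : Set (hermiteSobolev d p) :=
  {φ | hermiteNorm p (φ : RealTempered d) ≤ lam}

/-- The squared Hilbert-Schmidt norm `‖T‖²_{HS(q)} = ∑ᵢ ‖T eᵢ‖_q²` of a linear operator `T` on
`ℝ^n`, with `e₁, …, eₙ` the standard basis. -/
def hilbertSchmidtSq {d n : ℕ} (q : ℝ)
    (T : EuclideanSpace ℝ (Fin n) →ₗ[ℝ] RealTempered d) : ℝ :=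
  ∑ i, hermiteNorm q (T (EuclideanSpace.single i (1 : ℝ))) ^ 2

/-! ### The quasi-linear operators -/

section Operators

variable {d n : ℕ} {p : ℝ}

/-- The coefficient `aᵢⱼ(φ) = (σ(φ) σ(φ)ᵗ)ᵢⱼ`. -/
def diffusionMatrix (σ : Fin d → Fin n → hermiteSobolev d p → ℝ) (φ : hermiteSobolev d p) :
    Matrix (Fin d) (Fin d) ℝ :=
  (Matrix.of fun i j => σ i j φ) * (Matrix.of fun i j => σ i j φ).transpose

/-- `Aᵢ(φ) = -∑ₖ σₖᵢ(φ) ∂ₖ φ`. -/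
def operatorAComp (σ : Fin d → Fin n → hermiteSobolev d p → ℝ) (i : Fin n)
    (φ : hermiteSobolev d p) : RealTempered d :=
  -∑ k, σ k i φ • RealTempered.partialDeriv k (φ : RealTempered d)

/-- The operator `A(φ)` on `ℝ^n`, `A(φ) · h = ∑ᵢ hᵢ Aᵢ(φ)`. -/
def operatorA (σ : Fin d → Fin n → hermiteSobolev d p → ℝ) (φ : hermiteSobolev d p) :
    EuclideanSpace ℝ (Fin n) →ₗ[ℝ] RealTempered d where
  toFun h := ∑ i, h i • operatorAComp σ i φ
  map_add' h h' := by simp [add_smul, Finset.sum_add_distrib]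
  map_smul' c h := by simp [mul_smul, Finset.smul_sum]

/-- `L(φ) = ½ ∑ᵢⱼ aᵢⱼ(φ) ∂²ᵢⱼ φ - ∑ᵢ bᵢ(φ) ∂ᵢ φ`. -/
def operatorL (σ : Fin d → Fin n → hermiteSobolev d p → ℝ) (b : Fin d → hermiteSobolev d p → ℝ)
    (φ : hermiteSobolev d p) : RealTempered d :=
  (1 / 2 : ℝ) • ∑ i, ∑ j, diffusionMatrix σ φ i j •
      RealTempered.partialDeriv i (RealTempered.partialDeriv j (φ : RealTempered d)) -
    ∑ i, b i φ • RealTempered.partialDeriv i (φ : RealTempered d)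

/-- `K₁(lam) = max_{i,j} sup_{‖φ‖_p ≤ lam} {|σᵢⱼ(φ)|², |bᵢ(φ)|}`. -/
def coeffSup (σ : Fin d → Fin n → hermiteSobolev d p → ℝ) (b : Fin d → hermiteSobolev d p → ℝ)
    (lam : ℝ) : ℝ :=
  sSup {r | ∃ φ ∈ hermiteBall d p lam, (∃ i j, r = |σ i j φ| ^ 2) ∨ ∃ i, r = |b i φ|}

end Operators

end

/-! In the Hermite basis each `∂ᵢ` is a difference of two ladder shifts with coefficients of size
`√kᵢ`, so it costs half a unit of the Sobolev index, and `q ≤ p - 1` is exactly what two derivatives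
need.

Put `w = φ - ψ`. Splitting both differences so that the coefficients at `φ` act on derivatives of
`w` and the coefficient differences act on derivatives of `ψ`, the dangerous terms are `⟨w,
∂ᵢ∂ⱼw⟩_q` from `L` and `⟨∂ᵢw, ∂ⱼw⟩_q` from `A`. Neither is controlled by `‖w‖_q²` alone, but they
appear with the same coefficient `σᵢₗσⱼₗ`, and their sum is controlled because `∂ᵢ` is nearly
antisymmetric for `⟨·,·⟩_q`.

That near-antisymmetry is `exists_abs_hermiteInner_partialDeriv_add_le`. The ladder coefficients
cancel exactly, leaving only the difference of neighbouring weights. With `m = 2|k| + d` this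
difference is `O(m^(2q-1))`; multiplied by `√kᵢ` it leaves `m^q · m^(q-1/2)`, a gain of half an
index, which pays for the remaining `∂ⱼw`. The same estimate bounds `⟨w, ∂ᵢw⟩_q`, and moves the
derivative from `w` to `ψ` in the cross terms `⟨∂ᵢw, ∂ⱼψ⟩_q`. All other terms follow from
Cauchy-Schwarz, the Lipschitz bounds and `‖ψ‖_p ≤ λ`.

`exists_derivative_bounds` collects the analytic estimates; `monotonicity_identity` and
`monotonicity_of_bounds` do the algebra in an arbitrary inner product space, applied in `ℓ²`. -/

noncomputable section

/-! ### Derivatives of the Hermite functions -/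

/-- The derivative of a Hermite polynomial, `He'_{n+1} = (n + 1) He_n`. -/
theorem derivative_hermite_succ (n : ℕ) :
    Polynomial.derivative (Polynomial.hermite (n + 1)) =
      ((n : Polynomial ℤ) + 1) * Polynomial.hermite n := by
  induction n with
  | zero => simp
  | succ n ih =>
    rw [Polynomial.hermite_succ (n + 1), Polynomial.derivative_sub, Polynomial.derivative_mul, ih,
      Polynomial.derivative_mul, Polynomial.hermite_succ n]
    simp only [Polynomial.derivative_X, Polynomial.derivative_add, Polynomial.derivative_natCast,
      Polynomial.derivative_one]
    push_cast
    ring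

/-- The derivative of a Hermite polynomial, `He'_n = n He_{n-1}`. -/
theorem derivative_hermite (n : ℕ) :
    Polynomial.derivative (Polynomial.hermite n) =
      (n : Polynomial ℤ) * Polynomial.hermite (n - 1) := by
  cases n with
  | zero => simp
  | succ n => simpa using derivative_hermite_succ n

/-- The normalising constants satisfy `√(n + 1) c_{n + 1} = c_n`. -/
theorem sqrt_succ_mul_hermite_normalization (n : ℕ) :
    Real.sqrt ((n : ℝ) + 1) *
        (Real.sqrt (((n + 1).factorial : ℝ) * Real.sqrt Real.pi))⁻¹ =
      (Real.sqrt ((n.factorial : ℝ) * Real.sqrt Real.pi))⁻¹ := by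
  have h : Real.sqrt (((n + 1).factorial : ℝ) * Real.sqrt Real.pi) =
      Real.sqrt ((n : ℝ) + 1) * Real.sqrt ((n.factorial : ℝ) * Real.sqrt Real.pi) := by
    rw [← Real.sqrt_mul (by positivity), Nat.factorial_succ]
    push_cast
    ring_nf
  have h0 : Real.sqrt ((n : ℝ) + 1) ≠ 0 := (Real.sqrt_pos.2 (by positivity)).ne'
  rw [h, mul_inv, mul_inv_cancel_left₀ h0]

/-- `h_n' = √(n/2) h_{n-1} - √((n+1)/2) h_{n+1}`. -/
theorem hasDerivAt_hermiteFun (n : ℕ) (x : ℝ) :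
    HasDerivAt (hermiteFun n)
      (Real.sqrt (n / 2) * hermiteFun (n - 1) x -
        Real.sqrt (((n : ℝ) + 1) / 2) * hermiteFun (n + 1) x) x := by
  have h1 : HasDerivAt (fun y : ℝ => Real.sqrt 2 * y) (Real.sqrt 2) x := by
    simpa using (hasDerivAt_id x).const_mul (Real.sqrt 2)
  have h2 := ((Polynomial.hermite n).hasDerivAt_aeval (Real.sqrt 2 * x)).comp x h1
  have h3 : HasDerivAt (fun y : ℝ => Real.exp (-y ^ 2 / 2)) (Real.exp (-x ^ 2 / 2) * -x) x := by
    exact (((hasDerivAt_pow 2 x).neg.div_const 2).congr_deriv (by push_cast; ring)).exp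
  have h4 := ((h2.const_mul
    (Real.sqrt ((n.factorial : ℝ) * Real.sqrt Real.pi))⁻¹).mul h3)
  refine h4.congr_deriv ?_
  simp only [Function.comp_def, hermiteFun]
  set s := Real.sqrt 2 with hs
  have hs2 : s * s = 2 := Real.mul_self_sqrt (by norm_num)
  have hs0 : s ≠ 0 := (Real.sqrt_pos.2 (by norm_num)).ne'
  have hrec : Polynomial.aeval (s * x) (Polynomial.hermite (n + 1)) =
      s * x * Polynomial.aeval (s * x) (Polynomial.hermite n) -
        n * Polynomial.aeval (s * x) (Polynomial.hermite (n - 1)) := by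
    rw [Polynomial.hermite_succ, derivative_hermite]
    simp
  have hder : Polynomial.aeval (s * x) (Polynomial.derivative (Polynomial.hermite n)) =
      n * Polynomial.aeval (s * x) (Polynomial.hermite (n - 1)) := by
    rw [derivative_hermite]
    simp
  rw [hder, Real.sqrt_div (by positivity), Real.sqrt_div (by positivity), ← hs, hrec]
  have hup := sqrt_succ_mul_hermite_normalization n
  -- At `n = 0` the truncated index `n - 1` is meaningless, but both sides carry a factor `0`.
  have hdown : Real.sqrt n *
      (Real.sqrt (((n - 1).factorial : ℝ) * Real.sqrt Real.pi))⁻¹ *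
        Polynomial.aeval (s * x) (Polynomial.hermite (n - 1)) =
      n * (Real.sqrt ((n.factorial : ℝ) * Real.sqrt Real.pi))⁻¹ *
        Polynomial.aeval (s * x) (Polynomial.hermite (n - 1)) := by
    cases n with
    | zero => simp
    | succ m =>
      have := sqrt_succ_mul_hermite_normalization m
      simp only [Nat.add_sub_cancel, Nat.cast_add, Nat.cast_one] at this ⊢
      rw [← this, ← mul_assoc, Real.mul_self_sqrt (by positivity)]
  set c := (Real.sqrt ((n.factorial : ℝ) * Real.sqrt Real.pi))⁻¹
  set c₁ := (Real.sqrt (((n + 1).factorial : ℝ) * Real.sqrt Real.pi))⁻¹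
  set c₀ := (Real.sqrt (((n - 1).factorial : ℝ) * Real.sqrt Real.pi))⁻¹
  set P := Polynomial.aeval (s * x) (Polynomial.hermite n)
  set R := Polynomial.aeval (s * x) (Polynomial.hermite (n - 1))
  set e := Real.exp (-x ^ 2 / 2)
  calc _ = e * (c * (n * R * s - x * P)) := by ring
    -- Pulling out `1 / √2` matches the denominators of `√(n/2)` and `√((n+1)/2)`; the chain-rule
    -- factor `√2` becomes `2 / √2`, which splits `nR` evenly between the two shifts.
    _ = e * (1 / s) * (n * c * R - c * (s * x * P - n * R)) := by
        field_simp
        linear_combination e * c * n * R * hs2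
    _ = e * (1 / s) * (Real.sqrt n * c₀ * R - Real.sqrt ((n : ℝ) + 1) * c₁ * (s * x * P - n * R)) := by
        rw [hdown, hup]
    _ = _ := by ring

/-- `∂ᵢ h_k = √(kᵢ/2) h_{k - eᵢ} - √((kᵢ+1)/2) h_{k + eᵢ}`. -/
theorem lineDerivOp_hermiteSchwartz {d : ℕ} (i : Fin d) (k : Fin d → ℕ) :
    LineDeriv.lineDerivOp (EuclideanSpace.single i (1 : ℝ)) (hermiteSchwartz d k) =
      Real.sqrt ((k i : ℝ) / 2) • hermiteSchwartz d (k - Pi.single i 1) -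
        Real.sqrt (((k i : ℝ) + 1) / 2) • hermiteSchwartz d (k + Pi.single i 1) := by
  ext x
  rw [SchwartzMap.lineDerivOp_apply]
  simp only [sub_apply, smul_apply, smul_eq_mul]
  change lineDeriv ℝ (fun x : EuclideanSpace ℝ (Fin d) => ∏ j, hermiteFun (k j) (x j)) x _ =
    _ * ∏ j : Fin d, hermiteFun _ (x j) - _ * ∏ j : Fin d, hermiteFun _ (x j)
  -- Only the `i`-th factor varies along `eᵢ`, and only it feels the shift of `k`.
  simp only [← Finset.mul_prod_erase Finset.univ _ (Finset.mem_univ i)]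
  have hm : ∏ j ∈ Finset.univ.erase i, hermiteFun ((k - Pi.single i 1 : Fin d → ℕ) j) (x j) =
      ∏ j ∈ Finset.univ.erase i, hermiteFun (k j) (x j) :=
    Finset.prod_congr rfl fun j hj => by simp [(Finset.ne_of_mem_erase hj)]
  have hp : ∏ j ∈ Finset.univ.erase i, hermiteFun ((k + Pi.single i 1 : Fin d → ℕ) j) (x j) =
      ∏ j ∈ Finset.univ.erase i, hermiteFun (k j) (x j) :=
    Finset.prod_congr rfl fun j hj => by simp [(Finset.ne_of_mem_erase hj)]
  rw [hm, hp]
  simp only [Pi.add_apply, Pi.sub_apply, Pi.single_eq_same]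
  refine HasDerivAt.deriv (?_ : HasDerivAt _ _ (0 : ℝ))
  have hc : (fun t : ℝ => hermiteFun (k i) ((x + t • EuclideanSpace.single i (1 : ℝ)) i) *
      ∏ j ∈ Finset.univ.erase i, hermiteFun (k j) ((x + t • EuclideanSpace.single i (1 : ℝ)) j)) =
      fun t => hermiteFun (k i) (x i + t) * ∏ j ∈ Finset.univ.erase i, hermiteFun (k j) (x j) := by
    funext t
    congr 1
    · simp
    · exact Finset.prod_congr rfl fun j hj => by simp [(Finset.ne_of_mem_erase hj)]
  rw [hc]
  have h := hasDerivAt_hermiteFun (k i) (x i + 0)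
  refine ((h.comp_const_add (x i) 0).mul_const
    (∏ j ∈ Finset.univ.erase i, hermiteFun (k j) (x j))).congr_deriv ?_
  rw [add_zero]
  ring

/-- The Hermite coefficients of a partial derivative. -/
theorem partialDeriv_hermiteSchwartz {d : ℕ} (i : Fin d) (T : RealTempered d) (k : Fin d → ℕ) :
    RealTempered.partialDeriv i T (hermiteSchwartz d k) =
      Real.sqrt (((k i : ℝ) + 1) / 2) * T (hermiteSchwartz d (k + Pi.single i 1)) -
        Real.sqrt ((k i : ℝ) / 2) * T (hermiteSchwartz d (k - Pi.single i 1)) := by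
  have : RealTempered.partialDeriv i T (hermiteSchwartz d k) =
      -T (LineDeriv.lineDerivOp (EuclideanSpace.single i (1 : ℝ)) (hermiteSchwartz d k)) := rfl
  rw [this, lineDerivOp_hermiteSchwartz]
  simp

/-! ### Comparison of powers -/

/-- Neighbouring eigenvalues are `m` and `m + 2` with `m ≥ 1`, so their ratio lies between `1/3` and
`3`; the absolute value in the exponent covers both signs of `r`. -/
theorem rpow_le_three_rpow_mul_rpow {a b : ℝ} (r : ℝ) (ha : 0 < a) (hab : a ≤ 3 * b)
    (hba : b ≤ 3 * a) : a ^ r ≤ 3 ^ |r| * b ^ r := by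
  have hb : 0 < b := by linarith
  rw [← div_le_iff₀ (Real.rpow_pos_of_pos hb r), ← Real.div_rpow ha.le hb.le]
  rcases le_total 0 r with hr | hr
  · rw [abs_of_nonneg hr]
    exact Real.rpow_le_rpow (by positivity) (by rwa [div_le_iff₀ hb]) hr
  · rw [abs_of_nonpos hr, Real.rpow_neg (by norm_num), ← Real.inv_rpow (by norm_num)]
    refine Real.rpow_le_rpow_of_nonpos (by norm_num) ?_ hr
    rw [le_div_iff₀ hb]
    linarith

/-- Mean value inequality on `[m, m + 2]`: the `2` is the length of the interval, and the power of
`3` brings the derivative back to the left endpoint. -/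
theorem abs_rpow_add_two_sub_rpow_le {m : ℝ} (r : ℝ) (hm : 1 ≤ m) :
    |(m + 2) ^ r - m ^ r| ≤ 2 * |r| * 3 ^ |r - 1| * m ^ (r - 1) := by
  have h := (convex_Icc m (m + 2)).norm_image_sub_le_of_norm_hasDerivWithin_le
    (f := fun x : ℝ => x ^ r) (f' := fun x => r * x ^ (r - 1))
    (C := |r| * (3 ^ |r - 1| * m ^ (r - 1)))
    (fun x hx => (Real.hasDerivAt_rpow_const (Or.inl (by linarith [hx.1]))).hasDerivWithinAt)
    (fun x hx => by
      rw [Real.norm_eq_abs, abs_mul, abs_of_nonneg (Real.rpow_nonneg (by linarith [hx.1]) _)]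
      gcongr
      exact rpow_le_three_rpow_mul_rpow _ (by linarith [hx.1]) (by linarith [hx.2])
        (by linarith [hx.1]))
    (Set.left_mem_Icc.2 (by linarith)) (Set.right_mem_Icc.2 (by linarith))
  simp only [Real.norm_eq_abs, add_sub_cancel_left, abs_two] at h
  linarith

/-! ### Square-summable families -/

/-- The Cauchy-Schwarz inequality for a family dominated by a product. -/
theorem summable_and_abs_tsum_le_of_abs_le_mul {ι : Type*} {h f g : ι → ℝ} {A B C : ℝ} (hC : 0 ≤ C)
    (hf : Summable fun k => f k ^ 2) (hg : Summable fun k => g k ^ 2)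
    (hA : ∑' k, f k ^ 2 ≤ A ^ 2) (hB : ∑' k, g k ^ 2 ≤ B ^ 2) (hA0 : 0 ≤ A) (hB0 : 0 ≤ B)
    (hh : ∀ k, |h k| ≤ C * (|f k| * |g k|)) : Summable h ∧ |∑' k, h k| ≤ C * (A * B) := by
  have hs : ∀ s : Finset ι, ∑ k ∈ s, |h k| ≤ C * (A * B) := fun s => by
    calc ∑ k ∈ s, |h k| ≤ ∑ k ∈ s, C * (|f k| * |g k|) := Finset.sum_le_sum fun k _ => hh k
      _ = C * ∑ k ∈ s, |f k| * |g k| := by rw [Finset.mul_sum]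
      _ ≤ C * (Real.sqrt (∑ k ∈ s, |f k| ^ 2) * Real.sqrt (∑ k ∈ s, |g k| ^ 2)) := by
        gcongr
        exact Real.sum_mul_le_sqrt_mul_sqrt _ _ _
      _ ≤ C * (A * B) := by
        simp only [sq_abs]
        gcongr
        · exact Real.sqrt_le_iff.2 ⟨hA0, (hf.sum_le_tsum s fun _ _ => sq_nonneg _).trans hA⟩
        · exact Real.sqrt_le_iff.2 ⟨hB0, (hg.sum_le_tsum s fun _ _ => sq_nonneg _).trans hB⟩
  have hsum : Summable fun k => |h k| := summable_of_sum_le (fun _ => abs_nonneg _) hs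
  refine ⟨hsum.of_abs, ?_⟩
  have := norm_tsum_le_tsum_norm (f := h) hsum
  exact this.trans (hsum.tsum_le_of_sum_le hs)

theorem injective_add_single {d : ℕ} (i : Fin d) :
    Function.Injective fun k : Fin d → ℕ => k + Pi.single i 1 :=
  add_left_injective _

theorem summable_comp_add_single {d : ℕ} (i : Fin d) {F : (Fin d → ℕ) → ℝ} (hF : Summable F) :
    Summable fun k : Fin d → ℕ => F (k + Pi.single i 1) :=
  hF.comp_injective (injective_add_single i)

theorem tsum_comp_add_single_le {d : ℕ} (i : Fin d) {F : (Fin d → ℕ) → ℝ} (hF : Summable F)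
    (h0 : ∀ k, 0 ≤ F k) : ∑' k : Fin d → ℕ, F (k + Pi.single i 1) ≤ ∑' k, F k :=
  tsum_comp_le_tsum_of_inj hF h0 (injective_add_single i)

/-- A family vanishing on the multi-indices with `kᵢ = 0` has the same sum as its shift. -/
theorem hasSum_comp_add_single_iff {d : ℕ} (i : Fin d) {F : (Fin d → ℕ) → ℝ}
    (hF : ∀ k, k i = 0 → F k = 0) {a : ℝ} :
    HasSum (fun k : Fin d → ℕ => F (k + Pi.single i 1)) a ↔ HasSum F a := by
  refine (injective_add_single i).hasSum_iff fun k hk => hF k ?_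
  by_contra h
  refine hk ⟨k - Pi.single i 1, ?_⟩
  funext j
  rcases eq_or_ne j i with rfl | hj
  · simp
    omega
  · simp [hj]

/-! ### The weights -/

/-- The eigenvalue `2|k| + d` of the harmonic oscillator at `h_k`. -/
def hermiteEigenvalue {d : ℕ} (k : Fin d → ℕ) : ℝ := 2 * ((∑ j, k j : ℕ) : ℝ) + (d : ℝ)

theorem hermiteWeight_eq_rpow {d : ℕ} (r : ℝ) (k : Fin d → ℕ) :
    hermiteWeight r k = hermiteEigenvalue k ^ (2 * r) := rfl

theorem succ_le_hermiteEigenvalue {d : ℕ} (i : Fin d) (k : Fin d → ℕ) :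
    (k i : ℝ) + 1 ≤ hermiteEigenvalue k := by
  have h1 : k i ≤ ∑ j, k j := Finset.single_le_sum (fun _ _ => Nat.zero_le _) (Finset.mem_univ i)
  have h2 : 0 < d := i.pos
  rw [hermiteEigenvalue]
  exact_mod_cast (by omega : k i + 1 ≤ 2 * (∑ j, k j) + d)

theorem one_le_hermiteEigenvalue {d : ℕ} (i : Fin d) (k : Fin d → ℕ) :
    1 ≤ hermiteEigenvalue k := by
  have := succ_le_hermiteEigenvalue i k
  have : (0 : ℝ) ≤ k i := Nat.cast_nonneg _
  linarith

theorem hermiteEigenvalue_add_single {d : ℕ} (i : Fin d) (k : Fin d → ℕ) :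
    hermiteEigenvalue (k + Pi.single i 1) = hermiteEigenvalue k + 2 := by
  simp only [hermiteEigenvalue, Pi.add_apply, Finset.sum_add_distrib, Finset.sum_pi_single',
    Finset.mem_univ, if_true]
  simp
  ring

theorem hermiteWeight_le_mul_hermiteWeight_add_single {d : ℕ} (i : Fin d) (r : ℝ)
    (k : Fin d → ℕ) :
    hermiteWeight r k ≤ 3 ^ |2 * r| * hermiteWeight r (k + Pi.single i 1) := by
  have := one_le_hermiteEigenvalue i k
  rw [hermiteWeight_eq_rpow, hermiteWeight_eq_rpow, hermiteEigenvalue_add_single]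
  exact rpow_le_three_rpow_mul_rpow _ (by linarith) (by linarith) (by linarith)

theorem hermiteWeight_add_single_le_mul_hermiteWeight {d : ℕ} (i : Fin d) (r : ℝ)
    (k : Fin d → ℕ) :
    hermiteWeight r (k + Pi.single i 1) ≤ 3 ^ |2 * r| * hermiteWeight r k := by
  have := one_le_hermiteEigenvalue i k
  rw [hermiteWeight_eq_rpow, hermiteWeight_eq_rpow, hermiteEigenvalue_add_single]
  exact rpow_le_three_rpow_mul_rpow _ (by linarith) (by linarith) (by linarith)

/-- The weight has exponent `2r`, so half a unit of index is worth one eigenvalue, the size of a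
squared ladder coefficient. -/
theorem hermiteWeight_eq_hermiteEigenvalue_mul {d : ℕ} (i : Fin d) (r : ℝ) (k : Fin d → ℕ) :
    hermiteWeight r k = hermiteEigenvalue k * hermiteWeight (r - 1 / 2) k := by
  have := one_le_hermiteEigenvalue i k
  rw [hermiteWeight_eq_rpow, hermiteWeight_eq_rpow]
  nth_rw 2 [← Real.rpow_one (hermiteEigenvalue k)]
  rw [← Real.rpow_add (by linarith)]
  ring_nf

theorem hermiteWeight_eq_sq {d : ℕ} (r : ℝ) (k : Fin d → ℕ) :
    hermiteWeight r k = (hermiteEigenvalue k ^ r) ^ 2 := by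
  rw [hermiteWeight_eq_rpow, mul_comm, Real.rpow_mul, Real.rpow_two]
  unfold hermiteEigenvalue
  positivity

/-- The discrete derivative of the weight loses one full power, of which a ladder coefficient
gives back one half. -/
theorem abs_hermiteWeight_sub_mul_sqrt_le {d : ℕ} (i : Fin d) (q : ℝ) (k : Fin d → ℕ) :
    |hermiteWeight q (k + Pi.single i 1) - hermiteWeight q k| * Real.sqrt (((k i : ℝ) + 1) / 2) ≤
      2 * |2 * q| * 3 ^ |2 * q - 1| *
        (hermiteEigenvalue k ^ q * hermiteEigenvalue k ^ (q - 1 / 2)) := by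
  have h1 := one_le_hermiteEigenvalue i k
  have h2 := succ_le_hermiteEigenvalue i k
  have h0 : 0 < hermiteEigenvalue k := by linarith
  rw [hermiteWeight_eq_rpow, hermiteWeight_eq_rpow, hermiteEigenvalue_add_single,
    ← Real.rpow_add h0]
  have h3 : Real.sqrt (((k i : ℝ) + 1) / 2) ≤ hermiteEigenvalue k ^ (1 / 2 : ℝ) := by
    rw [← Real.sqrt_eq_rpow]
    exact Real.sqrt_le_sqrt (by linarith)
  calc _ ≤ (2 * |2 * q| * 3 ^ |2 * q - 1| * hermiteEigenvalue k ^ (2 * q - 1)) *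
        hermiteEigenvalue k ^ (1 / 2 : ℝ) :=
        mul_le_mul (abs_rpow_add_two_sub_rpow_le _ h1) h3 (Real.sqrt_nonneg _) (by positivity)
    _ = _ := by
        rw [mul_assoc, ← Real.rpow_add h0]
        ring_nf

/-! ### Norms and inner products of the Hermite-Sobolev spaces -/

theorem hermiteNorm_nonneg {d : ℕ} (r : ℝ) (T : RealTempered d) : 0 ≤ hermiteNorm r T :=
  Real.sqrt_nonneg _

theorem hermiteNorm_sq {d : ℕ} (r : ℝ) (T : RealTempered d) :
    hermiteNorm r T ^ 2 = ∑' k, hermiteWeight r k * T (hermiteSchwartz d k) ^ 2 := by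
  have h : hermiteInner r T T = ∑' k, hermiteWeight r k * T (hermiteSchwartz d k) ^ 2 :=
    tsum_congr fun k => by ring
  rw [hermiteNorm, h, Real.sq_sqrt]
  exact tsum_nonneg fun k => mul_nonneg (hermiteWeight_nonneg r k) (sq_nonneg _)

theorem hermiteInner_comm {d : ℕ} (r : ℝ) (S T : RealTempered d) :
    hermiteInner r S T = hermiteInner r T S :=
  tsum_congr fun k => by ring

/-- The index `i` certifies `d > 0`, hence eigenvalues at least `1`. For `d = 0` the only weight is
`0 ^ (2r)`, which is not monotone in `r`. -/
theorem hermiteNorm_mono {d : ℕ} (i : Fin d) {q p : ℝ} (h : q ≤ p) {T : RealTempered d}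
    (hT : T ∈ hermiteSobolev d p) : hermiteNorm q T ≤ hermiteNorm p T := by
  refine (sq_le_sq₀ (hermiteNorm_nonneg q T) (hermiteNorm_nonneg p T)).1 ?_
  rw [hermiteNorm_sq, hermiteNorm_sq]
  refine Summable.tsum_le_tsum (fun k => ?_) (hermiteSobolev_mono d h hT) hT
  exact mul_le_mul_of_nonneg_right (Real.rpow_le_rpow_of_exponent_le
    (one_le_hermiteEigenvalue i k) (by linarith)) (sq_nonneg _)

/-! ### The ladder operators on weighted sequences -/

section Ladder

variable {d : ℕ} (i : Fin d) (r : ℝ) {c : (Fin d → ℕ) → ℝ}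

theorem hermiteWeight_mul_succ_div_two_le (k : Fin d → ℕ) :
    hermiteWeight (r - 1 / 2) k * (((k i : ℝ) + 1) / 2) ≤ hermiteWeight r k := by
  rw [hermiteWeight_eq_hermiteEigenvalue_mul i r k, mul_comm (hermiteEigenvalue k)]
  have := succ_le_hermiteEigenvalue i k
  have : (0 : ℝ) ≤ k i := Nat.cast_nonneg _
  exact mul_le_mul_of_nonneg_left (by linarith) (hermiteWeight_nonneg _ _)

theorem summable_lowering_and_tsum_le (hc : Summable fun k => hermiteWeight r k * c k ^ 2) :
    (Summable fun k : Fin d → ℕ => hermiteWeight (r - 1 / 2) k *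
      (Real.sqrt (((k i : ℝ) + 1) / 2) * c (k + Pi.single i 1)) ^ 2) ∧
    ∑' k : Fin d → ℕ, hermiteWeight (r - 1 / 2) k *
      (Real.sqrt (((k i : ℝ) + 1) / 2) * c (k + Pi.single i 1)) ^ 2 ≤
        3 ^ |2 * r| * ∑' k, hermiteWeight r k * c k ^ 2 := by
  have hle : ∀ k : Fin d → ℕ, hermiteWeight (r - 1 / 2) k *
      (Real.sqrt (((k i : ℝ) + 1) / 2) * c (k + Pi.single i 1)) ^ 2 ≤
      3 ^ |2 * r| * (hermiteWeight r (k + Pi.single i 1) * c (k + Pi.single i 1) ^ 2) := by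
    intro k
    rw [mul_pow, Real.sq_sqrt (by positivity), ← mul_assoc, ← mul_assoc]
    exact mul_le_mul_of_nonneg_right ((hermiteWeight_mul_succ_div_two_le i r k).trans
      (hermiteWeight_le_mul_hermiteWeight_add_single i r k)) (sq_nonneg _)
  have hs := (summable_comp_add_single i hc).mul_left (3 ^ |2 * r|)
  have hsum := Summable.of_nonneg_of_le
    (fun k => mul_nonneg (hermiteWeight_nonneg _ k) (sq_nonneg _)) hle hs
  refine ⟨hsum, (hsum.tsum_le_tsum hle hs).trans ?_⟩
  rw [tsum_mul_left]
  refine mul_le_mul_of_nonneg_left ?_ (by positivity)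
  exact tsum_comp_add_single_le i hc fun k => mul_nonneg (hermiteWeight_nonneg _ k) (sq_nonneg _)

/-- The factor `√(kᵢ/2)` kills the indices with `kᵢ = 0`, where `k - eᵢ` is truncated, so the sum
can be reindexed over `k + eᵢ` without loss. -/
theorem summable_raising_and_tsum_le (hc : Summable fun k => hermiteWeight r k * c k ^ 2) :
    (Summable fun k : Fin d → ℕ => hermiteWeight (r - 1 / 2) k *
      (Real.sqrt ((k i : ℝ) / 2) * c (k - Pi.single i 1)) ^ 2) ∧
    ∑' k : Fin d → ℕ, hermiteWeight (r - 1 / 2) k *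
      (Real.sqrt ((k i : ℝ) / 2) * c (k - Pi.single i 1)) ^ 2 ≤
        3 ^ |2 * (r - 1 / 2)| * ∑' k, hermiteWeight r k * c k ^ 2 := by
  set F : (Fin d → ℕ) → ℝ := fun k => hermiteWeight (r - 1 / 2) k *
      (Real.sqrt ((k i : ℝ) / 2) * c (k - Pi.single i 1)) ^ 2 with hF
  have hF0 : ∀ k, k i = 0 → F k = 0 := fun k hk => by simp [hF, hk]
  have hle : ∀ k : Fin d → ℕ, F (k + Pi.single i 1) ≤
      3 ^ |2 * (r - 1 / 2)| * (hermiteWeight r k * c k ^ 2) := by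
    intro k
    simp only [hF, Pi.add_apply, Pi.single_eq_same, add_tsub_cancel_right, Nat.cast_add,
      Nat.cast_one]
    rw [mul_pow, Real.sq_sqrt (by positivity), ← mul_assoc, ← mul_assoc]
    refine mul_le_mul_of_nonneg_right ?_ (sq_nonneg _)
    calc _ ≤ 3 ^ |2 * (r - 1 / 2)| * hermiteWeight (r - 1 / 2) k * (((k i : ℝ) + 1) / 2) :=
          mul_le_mul_of_nonneg_right (hermiteWeight_add_single_le_mul_hermiteWeight i _ k)
            (by positivity)
      _ ≤ _ := by
          rw [mul_assoc]
          exact mul_le_mul_of_nonneg_left (hermiteWeight_mul_succ_div_two_le i r k) (by positivity)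
  have hs := hc.mul_left (3 ^ |2 * (r - 1 / 2)|)
  have hsum : Summable fun k : Fin d → ℕ => F (k + Pi.single i 1) := Summable.of_nonneg_of_le
    (fun k => mul_nonneg (hermiteWeight_nonneg _ _) (sq_nonneg _)) hle hs
  have hFsum := (hasSum_comp_add_single_iff i hF0).1 hsum.hasSum
  refine ⟨hFsum.summable, ?_⟩
  rw [hFsum.tsum_eq, ← tsum_mul_left]
  exact hsum.tsum_le_tsum hle hs

/-- The product of two families that are square-summable for the weight is summable. -/
theorem summable_hermiteWeight_mul_mul {a b : (Fin d → ℕ) → ℝ}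
    (ha : Summable fun k => hermiteWeight r k * a k ^ 2)
    (hb : Summable fun k => hermiteWeight r k * b k ^ 2) :
    Summable fun k => hermiteWeight r k * (a k * b k) := by
  refine Summable.of_norm_bounded (ha.add hb) fun k => ?_
  have hw := hermiteWeight_nonneg r k
  rw [Real.norm_eq_abs, abs_mul, abs_of_nonneg hw, ← mul_add]
  exact mul_le_mul_of_nonneg_left (abs_le.2 ⟨by nlinarith [sq_nonneg (a k + b k)],
    by nlinarith [sq_nonneg (a k - b k)]⟩) hw

end Ladder

/-! ### Partial derivatives on the Hermite-Sobolev spaces -/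

/-- `∂ᵢ` maps `S_r` boundedly into `S_{r - 1/2}`. -/
theorem partialDeriv_mem_and_hermiteNorm_sq_le {d : ℕ} (i : Fin d) (r : ℝ) {T : RealTempered d}
    (hT : T ∈ hermiteSobolev d r) :
    T.partialDeriv i ∈ hermiteSobolev d (r - 1 / 2) ∧
    hermiteNorm (r - 1 / 2) (T.partialDeriv i) ^ 2 ≤
      2 * (3 ^ |2 * r| + 3 ^ |2 * (r - 1 / 2)|) * hermiteNorm r T ^ 2 := by
  obtain ⟨hu, hu'⟩ := summable_lowering_and_tsum_le i r (c := fun k => T (hermiteSchwartz d k)) hT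
  obtain ⟨hv, hv'⟩ := summable_raising_and_tsum_le i r (c := fun k => T (hermiteSchwartz d k)) hT
  have hle : ∀ k, hermiteWeight (r - 1 / 2) k * T.partialDeriv i (hermiteSchwartz d k) ^ 2 ≤
      2 * (hermiteWeight (r - 1 / 2) k *
        (Real.sqrt (((k i : ℝ) + 1) / 2) * T (hermiteSchwartz d (k + Pi.single i 1))) ^ 2 +
      hermiteWeight (r - 1 / 2) k *
        (Real.sqrt ((k i : ℝ) / 2) * T (hermiteSchwartz d (k - Pi.single i 1))) ^ 2) := by
    intro k
    rw [partialDeriv_hermiteSchwartz, ← mul_add, mul_left_comm]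
    refine mul_le_mul_of_nonneg_left ?_ (hermiteWeight_nonneg _ _)
    nlinarith [sq_nonneg (Real.sqrt (((k i : ℝ) + 1) / 2) *
      T (hermiteSchwartz d (k + Pi.single i 1)) +
        Real.sqrt ((k i : ℝ) / 2) * T (hermiteSchwartz d (k - Pi.single i 1)))]
  have hs := (hu.add hv).mul_left 2
  have hsum := Summable.of_nonneg_of_le
    (fun k => mul_nonneg (hermiteWeight_nonneg _ k) (sq_nonneg _)) hle hs
  refine ⟨hsum, ?_⟩
  rw [hermiteNorm_sq, hermiteNorm_sq]
  refine (hsum.tsum_le_tsum hle hs).trans ?_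
  rw [tsum_mul_left, hu.tsum_add hv]
  linarith

theorem partialDeriv_mem {d : ℕ} (i : Fin d) {r s : ℝ} (h : s ≤ r - 1 / 2) {T : RealTempered d}
    (hT : T ∈ hermiteSobolev d r) : T.partialDeriv i ∈ hermiteSobolev d s :=
  hermiteSobolev_mono d h (partialDeriv_mem_and_hermiteNorm_sq_le i r hT).1

theorem exists_hermiteNorm_partialDeriv_le (d : ℕ) (r : ℝ) :
    ∃ D : ℝ, 0 ≤ D ∧ ∀ (i : Fin d), ∀ T ∈ hermiteSobolev d r,
      hermiteNorm (r - 1 / 2) (T.partialDeriv i) ≤ D * hermiteNorm r T := by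
  refine ⟨Real.sqrt (2 * (3 ^ |2 * r| + 3 ^ |2 * (r - 1 / 2)|)), Real.sqrt_nonneg _,
    fun i T hT => ?_⟩
  have h := Real.sqrt_le_sqrt (partialDeriv_mem_and_hermiteNorm_sq_le i r hT).2
  rwa [Real.sqrt_sq (hermiteNorm_nonneg _ _), Real.sqrt_mul (by positivity),
    Real.sqrt_sq (hermiteNorm_nonneg _ _)] at h

/-- Shifting the raising half by `eᵢ` puts the same ladder coefficient on both halves. In this form,
adding the series with `S` and `T` exchanged leaves only differences of weights. -/
theorem hasSum_hermiteInner_partialDeriv {d : ℕ} (i : Fin d) (q : ℝ) {S T : RealTempered d}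
    (hS : S ∈ hermiteSobolev d (q + 1 / 2)) (hT : T ∈ hermiteSobolev d q) :
    HasSum (fun k : Fin d → ℕ => Real.sqrt (((k i : ℝ) + 1) / 2) *
      (hermiteWeight q k * (S (hermiteSchwartz d (k + Pi.single i 1)) * T (hermiteSchwartz d k)) -
        hermiteWeight q (k + Pi.single i 1) *
          (S (hermiteSchwartz d k) * T (hermiteSchwartz d (k + Pi.single i 1)))))
      (hermiteInner q (S.partialDeriv i) T) := by
  have hu := (summable_lowering_and_tsum_le i (q + 1 / 2)
    (c := fun k => S (hermiteSchwartz d k)) hS).1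
  have hv := (summable_raising_and_tsum_le i (q + 1 / 2)
    (c := fun k => S (hermiteSchwartz d k)) hS).1
  rw [add_sub_cancel_right] at hu hv
  have hA := summable_hermiteWeight_mul_mul q hu hT
  have hB := summable_hermiteWeight_mul_mul q hv hT
  have hB' := (hasSum_comp_add_single_iff i (fun k hk => by simp [hk])).2 hB.hasSum
  have hsub := hA.hasSum.sub hB'
  rw [← hA.tsum_sub hB] at hsub
  have hval : hermiteInner q (S.partialDeriv i) T = _ := tsum_congr fun k => by
    rw [partialDeriv_hermiteSchwartz, mul_assoc, sub_mul, mul_sub]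
  rw [hval]
  refine hsub.congr_fun fun k => ?_
  simp only [Pi.add_apply, Pi.single_eq_same, add_tsub_cancel_right, Nat.cast_add, Nat.cast_one]
  ring

/-- The symmetric part of `∂ᵢ` for `⟨·, ·⟩_q` is an operator of order `-1/2`. -/
theorem exists_abs_hermiteInner_partialDeriv_add_le (d : ℕ) (q : ℝ) :
    ∃ M : ℝ, 0 ≤ M ∧ ∀ (i : Fin d), ∀ S ∈ hermiteSobolev d (q + 1 / 2),
      ∀ T ∈ hermiteSobolev d (q + 1 / 2),
      |hermiteInner q (S.partialDeriv i) T + hermiteInner q S (T.partialDeriv i)| ≤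
        M * (hermiteNorm q S * hermiteNorm (q - 1 / 2) T) := by
  set M₀ : ℝ := 2 * |2 * q| * 3 ^ |2 * q - 1| with hM₀
  have hM₀0 : 0 ≤ M₀ := by positivity
  -- One summand for each product, `S_k T_{k+eᵢ}` and `S_{k+eᵢ} T_k`; the power of `3` carries the
  -- eigenvalue to the shifted factor.
  refine ⟨M₀ * 3 ^ |q - 1 / 2| + M₀ * 3 ^ |q|, by positivity, fun i S hS T hT => ?_⟩
  have hSq := hermiteSobolev_mono d (by linarith : q ≤ q + 1 / 2) hS
  have hTq := hermiteSobolev_mono d (by linarith : q ≤ q + 1 / 2) hT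
  have hTl := hermiteSobolev_mono d (by linarith : q - 1 / 2 ≤ q) hTq
  have hsum := (hasSum_hermiteInner_partialDeriv i q hS hTq).add
    (hasSum_hermiteInner_partialDeriv i q hT hSq)
  rw [hermiteInner_comm q S]
  set w : (Fin d → ℕ) → ℝ := fun k =>
    (hermiteWeight q (k + Pi.single i 1) - hermiteWeight q k) * Real.sqrt (((k i : ℝ) + 1) / 2)
    with hw
  have hwle : ∀ k, |w k| ≤ M₀ * (hermiteEigenvalue k ^ q * hermiteEigenvalue k ^ (q - 1 / 2)) := by
    intro k
    rw [hw, abs_mul, abs_of_nonneg (Real.sqrt_nonneg _)]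
    exact abs_hermiteWeight_sub_mul_sqrt_le i q k
  have hpos : ∀ (k : Fin d → ℕ) (r : ℝ), 0 ≤ hermiteEigenvalue k ^ r := fun k r =>
    Real.rpow_nonneg (by linarith [one_le_hermiteEigenvalue i k]) _
  have hcmp : ∀ (k : Fin d → ℕ) (r : ℝ),
      hermiteEigenvalue k ^ r ≤ 3 ^ |r| * hermiteEigenvalue (k + Pi.single i 1) ^ r := by
    intro k r
    have := one_le_hermiteEigenvalue i k
    rw [hermiteEigenvalue_add_single]
    exact rpow_le_three_rpow_mul_rpow _ (by linarith) (by linarith) (by linarith)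
  have hsq : ∀ (r : ℝ) (R : RealTempered d),
      (fun k => (hermiteEigenvalue k ^ r * R (hermiteSchwartz d k)) ^ 2) =
        fun k => hermiteWeight r k * R (hermiteSchwartz d k) ^ 2 := fun r R => by
    funext k
    rw [mul_pow, hermiteWeight_eq_sq]
  have hmem : ∀ (r : ℝ) (R : RealTempered d), R ∈ hermiteSobolev d r →
      (Summable fun k => (hermiteEigenvalue k ^ r * R (hermiteSchwartz d k)) ^ 2) ∧
      ∑' k, (hermiteEigenvalue k ^ r * R (hermiteSchwartz d k)) ^ 2 ≤ hermiteNorm r R ^ 2 :=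
    fun r R hR => by
      rw [hsq, hermiteNorm_sq]
      exact ⟨hR, le_rfl⟩
  have hmem' : ∀ (r : ℝ) (R : RealTempered d), R ∈ hermiteSobolev d r →
      (Summable fun k : Fin d → ℕ => (hermiteEigenvalue (k + Pi.single i 1) ^ r *
        R (hermiteSchwartz d (k + Pi.single i 1))) ^ 2) ∧
      ∑' k : Fin d → ℕ, (hermiteEigenvalue (k + Pi.single i 1) ^ r *
        R (hermiteSchwartz d (k + Pi.single i 1))) ^ 2 ≤ hermiteNorm r R ^ 2 :=
    fun r R hR => ⟨summable_comp_add_single i (hmem r R hR).1,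
      (tsum_comp_add_single_le i (hmem r R hR).1 fun _ => sq_nonneg _).trans (hmem r R hR).2⟩
  obtain ⟨s1, b1⟩ := summable_and_abs_tsum_le_of_abs_le_mul
    (h := fun k => w k * (S (hermiteSchwartz d k) * T (hermiteSchwartz d (k + Pi.single i 1))))
    (C := M₀ * 3 ^ |q - 1 / 2|) (by positivity) (hmem q S hSq).1 (hmem' _ T hTl).1
    (hmem q S hSq).2 (hmem' _ T hTl).2 (hermiteNorm_nonneg _ _) (hermiteNorm_nonneg _ _)
    (fun k => by
      simp only [abs_mul, abs_of_nonneg (hpos _ _)]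
      calc |w k| * (|S (hermiteSchwartz d k)| * |T (hermiteSchwartz d (k + Pi.single i 1))|)
          ≤ M₀ * (hermiteEigenvalue k ^ q * (3 ^ |q - 1 / 2| *
              hermiteEigenvalue (k + Pi.single i 1) ^ (q - 1 / 2))) *
            (|S (hermiteSchwartz d k)| * |T (hermiteSchwartz d (k + Pi.single i 1))|) := by
            refine mul_le_mul_of_nonneg_right ((hwle k).trans ?_) (by positivity)
            exact mul_le_mul_of_nonneg_left (mul_le_mul_of_nonneg_left (hcmp k _) (hpos k _)) hM₀0
        _ = _ := by ring)
  obtain ⟨s2, b2⟩ := summable_and_abs_tsum_le_of_abs_le_mul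
    (h := fun k => w k * (S (hermiteSchwartz d (k + Pi.single i 1)) * T (hermiteSchwartz d k)))
    (C := M₀ * 3 ^ |q|) (by positivity) (hmem' q S hSq).1 (hmem _ T hTl).1
    (hmem' q S hSq).2 (hmem _ T hTl).2 (hermiteNorm_nonneg _ _) (hermiteNorm_nonneg _ _)
    (fun k => by
      simp only [abs_mul, abs_of_nonneg (hpos _ _)]
      calc |w k| * (|S (hermiteSchwartz d (k + Pi.single i 1))| * |T (hermiteSchwartz d k)|)
          ≤ M₀ * (3 ^ |q| * hermiteEigenvalue (k + Pi.single i 1) ^ q *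
              hermiteEigenvalue k ^ (q - 1 / 2)) *
            (|S (hermiteSchwartz d (k + Pi.single i 1))| * |T (hermiteSchwartz d k)|) := by
            refine mul_le_mul_of_nonneg_right ((hwle k).trans ?_) (by positivity)
            exact mul_le_mul_of_nonneg_left (mul_le_mul_of_nonneg_right (hcmp k _) (hpos k _)) hM₀0
        _ = _ := by ring)
  have hval := hsum.unique (((s1.hasSum.add s2.hasSum).neg).congr_fun fun k => by
    simp only [hw]
    ring)
  rw [hval, abs_neg, add_mul]
  exact (abs_add_le _ _).trans (add_le_add b1 b2)

/-! ### The monotonicity estimate in a Hilbert space -/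

section Abstract

open scoped InnerProductSpace

variable {E : Type*} [NormedAddCommGroup E] [InnerProductSpace ℝ E] {d n : ℕ}

/-- The constant of the monotonicity inequality in terms of the bounds for the derivatives (`M`),
for the coefficients (`s` and `B`), and for the Lipschitz constants of the coefficients (`K`). -/
def monotonicityConstant (d n : ℕ) (M s B K : ℝ) : ℝ :=
  n * (d * (d * (s ^ 2 * M + 4 * s * K * M + K ^ 2 * M ^ 2))) + 2 * (d * (B * M + K * M))

/-- Here `v`, `ww` stand for first and second derivatives of `w = φ - ψ`, and `u`, `uu` for those of
`ψ`. The factor `2 · ½` gives `⟪w, ww i j⟫` the same coefficient as `⟪v i, v j⟫`, so the two can be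
estimated together. -/
theorem monotonicity_identity (w : E) (v u : Fin d → E) (ww uu : Fin d → Fin d → E)
    (σ τ : Fin d → Fin n → ℝ) (b β : Fin d → ℝ) :
    2 * ⟪w, (1 / 2 : ℝ) • ∑ i, ∑ j, ((∑ l, σ i l * σ j l) • ww i j +
          (∑ l, σ i l * σ j l - ∑ l, τ i l * τ j l) • uu i j) -
        ∑ i, (b i • v i + (b i - β i) • u i)⟫_ℝ +
      ∑ l, ‖∑ k, (σ k l • v k + (σ k l - τ k l) • u k)‖ ^ 2 =
    ∑ l, ∑ i, ∑ j, (σ i l * σ j l * (⟪w, ww i j⟫_ℝ + ⟪v i, v j⟫_ℝ) +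
        (σ i l * σ j l - τ i l * τ j l) * ⟪w, uu i j⟫_ℝ +
        2 * (σ i l * (σ j l - τ j l) * ⟪v i, u j⟫_ℝ) +
        (σ i l - τ i l) * (σ j l - τ j l) * ⟪u i, u j⟫_ℝ) -
      2 * ∑ i, (b i * ⟪w, v i⟫_ℝ + (b i - β i) * ⟪w, u i⟫_ℝ) := by
  have h1 : 2 * ⟪w, (1 / 2 : ℝ) • ∑ i, ∑ j, ((∑ l, σ i l * σ j l) • ww i j +
          (∑ l, σ i l * σ j l - ∑ l, τ i l * τ j l) • uu i j) -
        ∑ i, (b i • v i + (b i - β i) • u i)⟫_ℝ =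
      ∑ l, ∑ i, ∑ j, (σ i l * σ j l * ⟪w, ww i j⟫_ℝ +
        (σ i l * σ j l - τ i l * τ j l) * ⟪w, uu i j⟫_ℝ) -
      2 * ∑ i, (b i * ⟪w, v i⟫_ℝ + (b i - β i) * ⟪w, u i⟫_ℝ) := by
    rw [inner_sub_right, real_inner_smul_right, mul_sub, ← mul_assoc]
    norm_num only [one_mul]
    congr 1
    · simp only [inner_sum, inner_add_right, real_inner_smul_right, ← Finset.sum_sub_distrib,
        Finset.sum_mul, ← Finset.sum_add_distrib]
      rw [Finset.sum_comm]
      conv_rhs => rw [Finset.sum_comm]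
      refine Eq.trans ?_ (Finset.sum_congr rfl fun i _ => Finset.sum_comm)
      exact Finset.sum_comm
    · simp only [inner_sum, inner_add_right, real_inner_smul_right]
  have h2 : ∀ l, ‖∑ k, (σ k l • v k + (σ k l - τ k l) • u k)‖ ^ 2 =
      ∑ i, ∑ j, (σ i l * σ j l * ⟪v i, v j⟫_ℝ +
        2 * (σ i l * (σ j l - τ j l) * ⟪v i, u j⟫_ℝ) +
        (σ i l - τ i l) * (σ j l - τ j l) * ⟪u i, u j⟫_ℝ) := by
    intro l
    rw [Finset.sum_add_distrib, norm_add_sq_real, ← real_inner_self_eq_norm_sq,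
      ← real_inner_self_eq_norm_sq]
    simp only [sum_inner, inner_sum, real_inner_smul_left, real_inner_smul_right, Finset.mul_sum,
      ← Finset.sum_add_distrib]
    rw [Finset.sum_comm]
    refine Finset.sum_congr rfl fun i _ => Finset.sum_congr rfl fun j _ => ?_
    ring
  rw [h1, Finset.sum_congr rfl fun l _ => h2 l, sub_add_eq_add_sub]
  congr 1
  simp only [← Finset.sum_add_distrib]
  refine Finset.sum_congr rfl fun l _ => Finset.sum_congr rfl fun i _ =>
    Finset.sum_congr rfl fun j _ => ?_
  ring

/-- Every term of the identity carries two factors `‖w‖`, each coming from a coefficient difference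
or from a pairing. No bound on `‖v i‖` or `‖ww i j‖` is assumed: the cancellation replaces it. -/
theorem monotonicity_of_bounds {w : E} {v u : Fin d → E} {ww uu : Fin d → Fin d → E}
    {σ τ : Fin d → Fin n → ℝ} {b β : Fin d → ℝ} {M s B K : ℝ}
    (hww : ∀ i j, |⟪w, ww i j⟫_ℝ + ⟪v i, v j⟫_ℝ| ≤ M * ‖w‖ ^ 2)
    (hvu : ∀ i j, |⟪v i, u j⟫_ℝ| ≤ M * ‖w‖) (hwv : ∀ i, |⟪w, v i⟫_ℝ| ≤ M * ‖w‖ ^ 2)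
    (hu : ∀ i, ‖u i‖ ≤ M) (huu : ∀ i j, ‖uu i j‖ ≤ M)
    (hσ : ∀ i l, |σ i l| ≤ s) (hτ : ∀ i l, |τ i l| ≤ s) (hb : ∀ i, |b i| ≤ B)
    (hστ : ∀ i l, |σ i l - τ i l| ≤ K * ‖w‖) (hbβ : ∀ i, |b i - β i| ≤ K * ‖w‖) :
    2 * ⟪w, (1 / 2 : ℝ) • ∑ i, ∑ j, ((∑ l, σ i l * σ j l) • ww i j +
          (∑ l, σ i l * σ j l - ∑ l, τ i l * τ j l) • uu i j) -
        ∑ i, (b i • v i + (b i - β i) • u i)⟫_ℝ +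
      ∑ l, ‖∑ k, (σ k l • v k + (σ k l - τ k l) • u k)‖ ^ 2 ≤
    monotonicityConstant d n M s B K * ‖w‖ ^ 2 := by
  rw [monotonicity_identity]
  have hinner : ∀ {x y : E} {a c : ℝ}, ‖x‖ ≤ a → ‖y‖ ≤ c → |⟪x, y⟫_ℝ| ≤ a * c :=
    fun {x y a c} hx hy => (abs_real_inner_le_norm x y).trans
      (mul_le_mul hx hy (norm_nonneg y) ((norm_nonneg x).trans hx))
  have habs : ∀ {x y a c : ℝ}, |x| ≤ a → |y| ≤ c → |x * y| ≤ a * c := fun {x y a c} hx hy => by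
    rw [abs_mul]
    exact mul_le_mul hx hy (abs_nonneg y) ((abs_nonneg x).trans hx)
  have hX : ∀ l i j, σ i l * σ j l * (⟪w, ww i j⟫_ℝ + ⟪v i, v j⟫_ℝ) +
        (σ i l * σ j l - τ i l * τ j l) * ⟪w, uu i j⟫_ℝ +
        2 * (σ i l * (σ j l - τ j l) * ⟪v i, u j⟫_ℝ) +
        (σ i l - τ i l) * (σ j l - τ j l) * ⟪u i, u j⟫_ℝ ≤
      (s ^ 2 * M + 4 * s * K * M + K ^ 2 * M ^ 2) * ‖w‖ ^ 2 := by
    -- The `4sKM` collects `σσ - ττ = σ(σ - τ) + (σ - τ)τ` (`e2`, `e3`) and twice the cross term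
    -- (`e4`).
    intro l i j
    have e1 := le_of_abs_le (habs (habs (hσ i l) (hσ j l)) (hww i j))
    have e2 := le_of_abs_le (habs (habs (hσ i l) (hστ j l)) (hinner (le_refl ‖w‖) (huu i j)))
    have e3 := le_of_abs_le (habs (habs (hστ i l) (hτ j l)) (hinner (le_refl ‖w‖) (huu i j)))
    have e4 := le_of_abs_le (habs (habs (hσ i l) (hστ j l)) (hvu i j))
    have e5 := le_of_abs_le (habs (habs (hστ i l) (hστ j l)) (hinner (hu i) (hu j)))
    linarith
  have hY : ∀ i, -((B * M + K * M) * ‖w‖ ^ 2) ≤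
      b i * ⟪w, v i⟫_ℝ + (b i - β i) * ⟪w, u i⟫_ℝ := by
    intro i
    have e1 := neg_le_of_abs_le (habs (hb i) (hwv i))
    have e2 := neg_le_of_abs_le (habs (hbβ i) (hinner (le_refl ‖w‖) (hu i)))
    linarith
  have hXs := Finset.sum_le_sum fun l (_ : l ∈ (Finset.univ : Finset (Fin n))) =>
    Finset.sum_le_sum fun i (_ : i ∈ (Finset.univ : Finset (Fin d))) =>
      Finset.sum_le_sum fun j (_ : j ∈ (Finset.univ : Finset (Fin d))) => hX l i j
  have hYs := Finset.sum_le_sum fun i (_ : i ∈ (Finset.univ : Finset (Fin d))) => hY i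
  simp only [Finset.sum_const, Finset.card_univ, Fintype.card_fin, nsmul_eq_mul] at hXs hYs
  rw [monotonicityConstant]
  linarith

end Abstract

/-! ### The isometric embedding into `ℓ²` -/

/-- The isometric embedding of `S_q` into `ℓ²`, `T ↦ ((2|k| + d)^q ⟨T, h_k⟩)ₖ`. -/
def hermiteSobolevToL2 (d : ℕ) (q : ℝ) :
    hermiteSobolev d q →ₗ[ℝ] lp (fun _ : Fin d → ℕ => ℝ) 2 where
  toFun T := ⟨fun k => hermiteEigenvalue k ^ q * (T : RealTempered d) (hermiteSchwartz d k), by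
    refine memℓp_gen ?_
    have h : Summable fun k => hermiteWeight q k *
      (T : RealTempered d) (hermiteSchwartz d k) ^ 2 := T.2
    refine h.congr fun k => ?_
    rw [ENNReal.toReal_ofNat, Real.rpow_two, Real.norm_eq_abs, sq_abs, mul_pow,
      hermiteWeight_eq_sq]⟩
  map_add' S T := by
    ext k
    exact mul_add _ _ _
  map_smul' c T := by
    ext k
    simp [mul_left_comm]

/-- Transfers Cauchy-Schwarz and the abstract estimate from `ℓ²` to `⟨·,·⟩_q`. -/
theorem inner_hermiteSobolevToL2 {d : ℕ} {q : ℝ} (S T : hermiteSobolev d q) :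
    inner ℝ (hermiteSobolevToL2 d q S) (hermiteSobolevToL2 d q T) =
      hermiteInner q (S : RealTempered d) T := by
  rw [lp.inner_eq_tsum]
  refine tsum_congr fun k => ?_
  rw [hermiteWeight_eq_sq, real_inner_eq_re_inner]
  simp [hermiteSobolevToL2]
  ring

theorem norm_hermiteSobolevToL2 {d : ℕ} {q : ℝ} (T : hermiteSobolev d q) :
    ‖hermiteSobolevToL2 d q T‖ = hermiteNorm q (T : RealTempered d) := by
  rw [hermiteNorm, ← inner_hermiteSobolevToL2, real_inner_self_eq_norm_sq,
    Real.sqrt_sq (norm_nonneg _)]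

/-! ### Bounds for the coefficients -/

section Coefficients

variable {d n : ℕ} {p : ℝ} {σ : Fin d → Fin n → hermiteSobolev d p → ℝ}
  {b : Fin d → hermiteSobolev d p → ℝ} {lam : ℝ}

theorem zero_mem_hermiteBall (hlam : 0 ≤ lam) : (0 : hermiteSobolev d p) ∈ hermiteBall d p lam := by
  simpa [hermiteBall, hermiteNorm, hermiteInner] using hlam

/-- Coefficients that are Lipschitz continuous on a ball are bounded there. -/
theorem bddAbove_coeff {q K : ℝ} (hqp : q ≤ p) (hlam : 0 ≤ lam) (hK : 0 ≤ K)
    (hL : ∀ φ ∈ hermiteBall d p lam, ∀ ψ ∈ hermiteBall d p lam,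
      (∀ i j, |σ i j φ - σ i j ψ| ≤ K * hermiteNorm q (φ - ψ : RealTempered d)) ∧
      (∀ i, |b i φ - b i ψ| ≤ K * hermiteNorm q (φ - ψ : RealTempered d))) :
    BddAbove {r | ∃ φ ∈ hermiteBall d p lam, (∃ i j, r = |σ i j φ| ^ 2) ∨ ∃ i, r = |b i φ|} := by
  -- The `Fin d` argument supplies the `d > 0` needed to compare the norms; each use below has an
  -- index at hand.
  have hdist : ∀ (_ : Fin d), ∀ φ ∈ hermiteBall d p lam,
      K * hermiteNorm q ((φ : RealTempered d) - ((0 : hermiteSobolev d p) : RealTempered d)) ≤ K * lam := by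
    intro i φ hφ
    refine mul_le_mul_of_nonneg_left ?_ hK
    rw [ZeroMemClass.coe_zero, sub_zero]
    exact (hermiteNorm_mono i hqp φ.2).trans hφ
  refine ⟨∑ i, ∑ j, (|σ i j 0| + K * lam) ^ 2 + ∑ i, (|b i 0| + K * lam), ?_⟩
  have h0 := zero_mem_hermiteBall (d := d) (p := p) hlam
  have hKl : 0 ≤ K * lam := mul_nonneg hK hlam
  rintro r ⟨φ, hφ, ⟨i, j, rfl⟩ | ⟨i, rfl⟩⟩
  · have h1 : |σ i j φ| ≤ |σ i j 0| + K * lam := by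
      have := ((hL φ hφ 0 h0).1 i j).trans (hdist i φ hφ)
      linarith [abs_sub_abs_le_abs_sub (σ i j φ) (σ i j 0)]
    calc |σ i j φ| ^ 2 ≤ (|σ i j 0| + K * lam) ^ 2 := by gcongr
      _ ≤ ∑ j, (|σ i j 0| + K * lam) ^ 2 :=
        Finset.single_le_sum (f := fun j => (|σ i j 0| + K * lam) ^ 2)
          (fun _ _ => sq_nonneg _) (Finset.mem_univ j)
      _ ≤ ∑ i, ∑ j, (|σ i j 0| + K * lam) ^ 2 :=
        Finset.single_le_sum (f := fun i => ∑ j, (|σ i j 0| + K * lam) ^ 2)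
          (fun _ _ => by positivity) (Finset.mem_univ i)
      _ ≤ _ := le_add_of_nonneg_right (by positivity)
  · have h1 : |b i φ| ≤ |b i 0| + K * lam := by
      have := ((hL φ hφ 0 h0).2 i).trans (hdist i φ hφ)
      linarith [abs_sub_abs_le_abs_sub (b i φ) (b i 0)]
    calc |b i φ| ≤ |b i 0| + K * lam := h1
      _ ≤ ∑ i, (|b i 0| + K * lam) :=
        Finset.single_le_sum (f := fun i => |b i 0| + K * lam)
          (fun _ _ => by positivity) (Finset.mem_univ i)
      _ ≤ _ := le_add_of_nonneg_left (by positivity)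

end Coefficients

/-! ### The quasi-linear operators -/

theorem RealTempered.partialDeriv_sub {d : ℕ} (i : Fin d) (S T : RealTempered d) :
    (S - T).partialDeriv i = S.partialDeriv i - T.partialDeriv i := by
  simp only [RealTempered.partialDeriv, ContinuousLinearMap.sub_comp]
  abel

section Operators

variable {d n : ℕ} {p q : ℝ} (σ : Fin d → Fin n → hermiteSobolev d p → ℝ)
  (b : Fin d → hermiteSobolev d p → ℝ)

theorem partialDeriv_partialDeriv_mem (hpq : q ≤ p - 1) (i j : Fin d) {T : RealTempered d}
    (hT : T ∈ hermiteSobolev d p) : (T.partialDeriv j).partialDeriv i ∈ hermiteSobolev d q :=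
  partialDeriv_mem i (by linarith) (partialDeriv_mem j le_rfl hT)

theorem operatorL_mem (hpq : q ≤ p - 1) (φ : hermiteSobolev d p) :
    operatorL σ b φ ∈ hermiteSobolev d q :=
  sub_mem (Submodule.smul_mem _ _ (sum_mem fun i _ => sum_mem fun j _ =>
      Submodule.smul_mem _ _ (partialDeriv_partialDeriv_mem hpq i j φ.2)))
    (sum_mem fun i _ => Submodule.smul_mem _ _ (partialDeriv_mem i (by linarith) φ.2))

theorem operatorA_mem (hpq : q ≤ p - 1) (φ : hermiteSobolev d p)
    (h : EuclideanSpace ℝ (Fin n)) : operatorA σ φ h ∈ hermiteSobolev d q :=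
  sum_mem fun _ _ => Submodule.smul_mem _ _ (neg_mem (sum_mem fun i _ =>
    Submodule.smul_mem _ _ (partialDeriv_mem i (by linarith) φ.2)))

/-- The split is asymmetric: unbounded derivatives of `φ - ψ` meet only coefficients at `φ`, while
coefficient differences meet derivatives of `ψ`, bounded on the ball. -/
theorem operatorL_sub (φ ψ : hermiteSobolev d p) :
    operatorL σ b φ - operatorL σ b ψ =
      (1 / 2 : ℝ) • ∑ i, ∑ j, ((∑ l, σ i l φ * σ j l φ) •
          (((φ : RealTempered d) - ψ).partialDeriv j).partialDeriv i +
        (∑ l, σ i l φ * σ j l φ - ∑ l, σ i l ψ * σ j l ψ) •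
          ((ψ : RealTempered d).partialDeriv j).partialDeriv i) -
      ∑ i, (b i φ • ((φ : RealTempered d) - ψ).partialDeriv i +
        (b i φ - b i ψ) • (ψ : RealTempered d).partialDeriv i) := by
  have ha : ∀ (χ : hermiteSobolev d p) i j,
      diffusionMatrix σ χ i j = ∑ l, σ i l χ * σ j l χ := fun χ i j => by
    simp [diffusionMatrix, Matrix.mul_apply]
  simp only [operatorL, ha, RealTempered.partialDeriv_sub]
  have hsum : ∀ f g h : Fin d → RealTempered d, (∀ i, f i - g i = h i) →
      ∑ i, f i - ∑ i, g i = ∑ i, h i := fun f g h hfg => by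
    rw [← Finset.sum_sub_distrib]
    exact Finset.sum_congr rfl fun i _ => hfg i
  set D := fun (χ : hermiteSobolev d p) i => (χ : RealTempered d).partialDeriv i
  set D₂ := fun (χ : hermiteSobolev d p) i j =>
    ((χ : RealTempered d).partialDeriv j).partialDeriv i
  have h₂ : ∑ i, ∑ j, (∑ l, σ i l φ * σ j l φ) • D₂ φ i j -
      ∑ i, ∑ j, (∑ l, σ i l ψ * σ j l ψ) • D₂ ψ i j =
      ∑ i, ∑ j, ((∑ l, σ i l φ * σ j l φ) • (D₂ φ i j - D₂ ψ i j) +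
        (∑ l, σ i l φ * σ j l φ - ∑ l, σ i l ψ * σ j l ψ) • D₂ ψ i j) :=
    hsum _ _ _ fun i => hsum _ _ _ fun j => by module
  have h₁ : ∑ i, b i φ • D φ i - ∑ i, b i ψ • D ψ i =
      ∑ i, (b i φ • (D φ i - D ψ i) + (b i φ - b i ψ) • D ψ i) :=
    hsum _ _ _ fun i => by module
  rw [← h₁, ← h₂]
  module

theorem operatorA_sub_single (φ ψ : hermiteSobolev d p) (l : Fin n) :
    (operatorA σ φ - operatorA σ ψ) (EuclideanSpace.single l (1 : ℝ)) =
      -∑ k, (σ k l φ • ((φ : RealTempered d) - ψ).partialDeriv k +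
        (σ k l φ - σ k l ψ) • (ψ : RealTempered d).partialDeriv k) := by
  have hA : ∀ χ : hermiteSobolev d p,
      operatorA σ χ (EuclideanSpace.single l (1 : ℝ)) = operatorAComp σ l χ := fun χ => by
    simp [operatorA, PiLp.single_apply, ite_smul]
  rw [LinearMap.sub_apply, hA, hA, operatorAComp, operatorAComp, neg_sub_neg,
    ← Finset.sum_sub_distrib, ← Finset.sum_neg_distrib]
  refine Finset.sum_congr rfl fun k _ => ?_
  rw [RealTempered.partialDeriv_sub]
  module

/-- The bounds for the derivatives that enter the monotonicity inequality. -/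
theorem exists_derivative_bounds (d : ℕ) {p q : ℝ} (hpq : q ≤ p - 1) :
    ∃ M : ℝ, 0 ≤ M ∧ ∀ (lam : ℝ), 0 ≤ lam → ∀ w ∈ hermiteSobolev d p, ∀ u ∈ hermiteSobolev d p,
      hermiteNorm p u ≤ lam → ∀ i j : Fin d,
      |hermiteInner q w ((w.partialDeriv j).partialDeriv i) +
        hermiteInner q (w.partialDeriv i) (w.partialDeriv j)| ≤
          M * (1 + lam) * hermiteNorm q w ^ 2 ∧
      |hermiteInner q (w.partialDeriv i) (u.partialDeriv j)| ≤
        M * (1 + lam) * hermiteNorm q w ∧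
      |hermiteInner q w (w.partialDeriv i)| ≤ M * (1 + lam) * hermiteNorm q w ^ 2 ∧
      hermiteNorm q (u.partialDeriv i) ≤ M * (1 + lam) ∧
      hermiteNorm q ((u.partialDeriv j).partialDeriv i) ≤ M * (1 + lam) := by
  obtain ⟨M, hM0, hM⟩ := exists_abs_hermiteInner_partialDeriv_add_le d q
  obtain ⟨Dq, hDq0, hDq⟩ := exists_hermiteNorm_partialDeriv_le d q
  obtain ⟨Dp, hDp0, hDp⟩ := exists_hermiteNorm_partialDeriv_le d p
  obtain ⟨D, hD0, hD⟩ := exists_hermiteNorm_partialDeriv_le d (p - 1 / 2)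
  have hMD : 0 ≤ M * Dq := mul_nonneg hM0 hDq0
  have hMDp : 0 ≤ M * Dp := mul_nonneg hM0 hDp0
  have hDD : 0 ≤ D * Dp := mul_nonneg hD0 hDp0
  -- The sum dominates every constant below, and `1 + lam` covers the bounds free of `lam` as well
  -- as those linear in it.
  set N := M * Dq + M + M * Dp + Dp + D * Dp with hN
  have hN0 : 0 ≤ N := by positivity
  refine ⟨N, hN0, fun lam hlam w hw u hu hul i j => ?_⟩
  have hNl : N ≤ N * (1 + lam) := le_mul_of_one_le_right hN0 (by linarith)
  have hle : ∀ {c : ℝ}, c ≤ N → c * lam ≤ N * (1 + lam) := fun {c} hc => by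
    nlinarith
  have hwq := hermiteSobolev_mono d (by linarith : q ≤ p) hw
  have hwh := hermiteSobolev_mono d (by linarith : q + 1 / 2 ≤ p) hw
  have hn := hermiteNorm_nonneg q w
  have hu1 : ∀ {r : ℝ} (i : Fin d), r ≤ p - 1 / 2 →
      hermiteNorm r (u.partialDeriv i) ≤ Dp * lam := fun i hr =>
    ((hermiteNorm_mono i hr (partialDeriv_mem i le_rfl hu)).trans (hDp i u hu)).trans
      (mul_le_mul_of_nonneg_left hul hDp0)
  have hu2 : hermiteNorm q ((u.partialDeriv j).partialDeriv i) ≤ D * Dp * lam := by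
    have h := partialDeriv_mem j (le_refl (p - 1 / 2)) hu
    refine ((hermiteNorm_mono i (by linarith : q ≤ p - 1 / 2 - 1 / 2)
      (partialDeriv_mem i le_rfl h)).trans (hD i _ h)).trans ?_
    rw [mul_assoc]
    exact mul_le_mul_of_nonneg_left (hu1 j le_rfl) hD0
  have hcs : ∀ T ∈ hermiteSobolev d q, |hermiteInner q w T| ≤ hermiteNorm q w * hermiteNorm q T :=
    fun T hT => by
      have h := abs_real_inner_le_norm (hermiteSobolevToL2 d q ⟨w, hwq⟩)
        (hermiteSobolevToL2 d q ⟨T, hT⟩)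
      rwa [inner_hermiteSobolevToL2, norm_hermiteSobolevToL2, norm_hermiteSobolevToL2] at h
  refine ⟨?_, ?_, ?_, ?_, ?_⟩
  -- Only `∂ᵢ` is moved, against `T = ∂ⱼw`, which lies in `S_{q+1/2}` since `q ≤ p - 1`. The half
  -- index gained absorbs `∂ⱼ`.
  · rw [add_comm]
    calc _ ≤ M * (hermiteNorm q w * hermiteNorm (q - 1 / 2) (w.partialDeriv j)) :=
          hM i w hwh _ (partialDeriv_mem j (by linarith) hw)
      _ ≤ M * (hermiteNorm q w * (Dq * hermiteNorm q w)) := by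
          gcongr
          exact hDq j w hwq
      _ = M * Dq * hermiteNorm q w ^ 2 := by ring
      _ ≤ N * (1 + lam) * hermiteNorm q w ^ 2 :=
          mul_le_mul_of_nonneg_right (by linarith) (sq_nonneg _)
  -- Integration by parts: `∂ᵢ` passes from `w` to `∂ⱼu`, and `∂ᵢ∂ⱼu` is still in `S_q`.
  · have h1 := hM i w hwh _ (partialDeriv_mem j (by linarith : q + 1 / 2 ≤ p - 1 / 2) hu)
    have h2 := hcs _ (partialDeriv_partialDeriv_mem hpq i j hu)
    calc _ ≤ |hermiteInner q (w.partialDeriv i) (u.partialDeriv j) +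
            hermiteInner q w ((u.partialDeriv j).partialDeriv i)| +
          |hermiteInner q w ((u.partialDeriv j).partialDeriv i)| := by
          simpa using abs_sub (hermiteInner q (w.partialDeriv i) (u.partialDeriv j) +
            hermiteInner q w ((u.partialDeriv j).partialDeriv i))
            (hermiteInner q w ((u.partialDeriv j).partialDeriv i))
      _ ≤ M * (hermiteNorm q w * (Dp * lam)) + hermiteNorm q w * (D * Dp * lam) := by
          refine add_le_add (h1.trans ?_) (h2.trans ?_)
          · gcongr
            exact hu1 j (by linarith)
          · gcongr
      _ = (M * Dp + D * Dp) * lam * hermiteNorm q w := by ring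
      _ ≤ N * (1 + lam) * hermiteNorm q w :=
          mul_le_mul_of_nonneg_right (hle (by linarith)) hn
  -- With `S = T = w` the two pairings coincide, so near-antisymmetry bounds the pairing itself.
  · have h1 := hM i w hwh w hwh
    rw [hermiteInner_comm q (w.partialDeriv i), ← two_mul, abs_mul, abs_two] at h1
    have h2 : hermiteNorm (q - 1 / 2) w ≤ hermiteNorm q w := hermiteNorm_mono i (by linarith) hwq
    have h3 : M * (hermiteNorm q w * hermiteNorm (q - 1 / 2) w) ≤ M * hermiteNorm q w ^ 2 := by
      rw [sq]
      gcongr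
    have h4 : M * hermiteNorm q w ^ 2 ≤ N * (1 + lam) * hermiteNorm q w ^ 2 :=
      mul_le_mul_of_nonneg_right (by linarith) (sq_nonneg _)
    linarith [abs_nonneg (hermiteInner q w (w.partialDeriv i))]
  · exact (hu1 i (by linarith)).trans (hle (by linarith))
  · exact hu2.trans (hle (by linarith))

end Operators

end

/-! ### The monotonicity inequality -/

theorem theorem3p2 (d n : ℕ) (p q : ℝ) (hpq : q ≤ p - 1) :
    ∃ C : ℝ → ℝ → ℝ → ℝ,
      ∀ (σ : Fin d → Fin n → hermiteSobolev d p → ℝ) (b : Fin d → hermiteSobolev d p → ℝ)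
        (lam K : ℝ), 0 < lam → 0 < K →
        (∀ φ ∈ hermiteBall d p lam, ∀ ψ ∈ hermiteBall d p lam,
          (∀ i j, |σ i j φ - σ i j ψ| ≤ K * hermiteNorm q (φ - ψ : RealTempered d)) ∧
          (∀ i, |b i φ - b i ψ| ≤ K * hermiteNorm q (φ - ψ : RealTempered d))) →
        (∀ φ : hermiteSobolev d p, operatorL σ b φ ∈ hermiteSobolev d q ∧
          ∀ h, operatorA σ φ h ∈ hermiteSobolev d q) ∧
        ∀ φ ∈ hermiteBall d p lam, ∀ ψ ∈ hermiteBall d p lam,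
          2 * hermiteInner q (φ - ψ : RealTempered d) (operatorL σ b φ - operatorL σ b ψ) +
              hilbertSchmidtSq q (operatorA σ φ - operatorA σ ψ) ≤
            C lam K (coeffSup σ b lam) * hermiteNorm q (φ - ψ : RealTempered d) ^ 2 := by

  obtain ⟨M, -, hM⟩ := exists_derivative_bounds d hpq
  -- `K₁` bounds `|σ|²` and `|b|`, hence `√K₁` for `σ` and `K₁` for `b`.
  refine ⟨fun lam K K₁ => monotonicityConstant d n (M * (1 + lam)) (Real.sqrt K₁) K₁ K,
    fun σ b lam K hlam hK hL => ⟨fun φ => ⟨operatorL_mem σ b hpq φ, operatorA_mem σ hpq φ⟩,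
      fun φ hφ ψ hψ => ?_⟩⟩
  -- Without boundedness the real `sSup` would default to `0` and bound nothing.
  have hbdd := bddAbove_coeff (by linarith) hlam.le hK.le hL
  have hσ : ∀ χ ∈ hermiteBall d p lam, ∀ i l, |σ i l χ| ≤ Real.sqrt (coeffSup σ b lam) :=
    fun χ hχ i l => Real.le_sqrt_of_sq_le (le_csSup hbdd ⟨χ, hχ, Or.inl ⟨i, l, rfl⟩⟩)
  have hb : ∀ χ ∈ hermiteBall d p lam, ∀ i, |b i χ| ≤ coeffSup σ b lam :=
    fun χ hχ i => le_csSup hbdd ⟨χ, hχ, Or.inr ⟨i, rfl⟩⟩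
  have hwp : (φ : RealTempered d) - ψ ∈ hermiteSobolev d p := sub_mem φ.2 ψ.2
  have hest := hM lam hlam.le _ hwp ψ ψ.2 hψ
  let J := hermiteSobolevToL2 d q
  let w : hermiteSobolev d q :=
    ⟨(φ : RealTempered d) - ψ, hermiteSobolev_mono d (by linarith) hwp⟩
  let v : Fin d → hermiteSobolev d q := fun i =>
    ⟨((φ : RealTempered d) - ψ).partialDeriv i, partialDeriv_mem i (by linarith) hwp⟩
  let u : Fin d → hermiteSobolev d q := fun i =>
    ⟨(ψ : RealTempered d).partialDeriv i, partialDeriv_mem i (by linarith) ψ.2⟩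
  let ww : Fin d → Fin d → hermiteSobolev d q := fun i j =>
    ⟨(((φ : RealTempered d) - ψ).partialDeriv j).partialDeriv i,
      partialDeriv_partialDeriv_mem hpq i j hwp⟩
  let uu : Fin d → Fin d → hermiteSobolev d q := fun i j =>
    ⟨((ψ : RealTempered d).partialDeriv j).partialDeriv i,
      partialDeriv_partialDeriv_mem hpq i j ψ.2⟩
  have hJ : ∀ T : hermiteSobolev d q, ‖J T‖ = hermiteNorm q (T : RealTempered d) :=
    norm_hermiteSobolevToL2
  have hJ2 : ∀ S T : hermiteSobolev d q,
      inner ℝ (J S) (J T) = hermiteInner q (S : RealTempered d) T := inner_hermiteSobolevToL2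
  have key := monotonicity_of_bounds (w := J w) (v := fun i => J (v i)) (u := fun i => J (u i))
    (ww := fun i j => J (ww i j)) (uu := fun i j => J (uu i j))
    (σ := fun i l => σ i l φ) (τ := fun i l => σ i l ψ) (b := fun i => b i φ)
    (β := fun i => b i ψ) (M := M * (1 + lam)) (K := K)
    (fun i j => by simpa only [hJ, hJ2] using (hest i j).1)
    (fun i j => by simpa only [hJ, hJ2] using (hest i j).2.1)
    (fun i => by simpa only [hJ, hJ2] using (hest i i).2.2.1)
    (fun i => by simpa only [hJ] using (hest i i).2.2.2.1)
    (fun i j => by simpa only [hJ] using (hest i j).2.2.2.2)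
    (hσ φ hφ) (hσ ψ hψ) (hb φ hφ)
    (fun i l => by simpa only [hJ] using (hL φ hφ ψ hψ).1 i l)
    (fun i => by simpa only [hJ] using (hL φ hφ ψ hψ).2 i)
  -- Linearity of `J` gathers each combination into the image of one element of `S_q`, so the
  -- estimate reads in `⟨·,·⟩_q`.
  simp only [← map_smul, ← map_add, ← map_sum, ← map_sub, hJ, hJ2] at key
  have hdrift : operatorL σ b φ - operatorL σ b ψ =
      (((1 / 2 : ℝ) • ∑ i, ∑ j, ((∑ l, σ i l φ * σ j l φ) • ww i j +
          (∑ l, σ i l φ * σ j l φ - ∑ l, σ i l ψ * σ j l ψ) • uu i j) -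
        ∑ i, (b i φ • v i + (b i φ - b i ψ) • u i) : hermiteSobolev d q) : RealTempered d) := by
    rw [operatorL_sub]
    simp [v, u, ww, uu]
  -- The minus sign in `A` disappears under the norm.
  have hnoise : ∀ l, hermiteNorm q
      ((operatorA σ φ - operatorA σ ψ) (EuclideanSpace.single l (1 : ℝ))) =
      hermiteNorm q ((∑ k, (σ k l φ • v k + (σ k l φ - σ k l ψ) • u k) :
        hermiteSobolev d q) : RealTempered d) := by
    intro l
    rw [operatorA_sub_single]
    simp [v, u, hermiteNorm, hermiteInner]
  rw [hdrift, hilbertSchmidtSq]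
  simp only [hnoise]
  exact key
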